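/- Let \(k\) be a field, \(V\) a finite-dimensional \(k\)-vector space and \(r_0\ge 0\) an integer. A *symmetric algebra structure* on \(V\) is a pair \((b,(S_r)_{r\ge r_0})\), where \(b\) is a non-degenerate symmetric bilinear form on \(V\) and the \(S_r\colon V^{\otimes r}\to k\) are linear maps with \(S_r(X_1\otimes\dots\otimes X_r)=S_r(X_{\sigma(1)}\otimes\dots\otimes X_{\sigma(r)})\) for all \(X_1,\dots,X_r\in V\) and all permutations \(\sigma\in\mathfrak S_r\). A *graph of type \((p,q)\)* consists of a finite set of vertices, a finite set of half-edges, each stemming from a vertex, \(p\) ordered ingoing and \(q\) ordered outgoing end points, and a finite set of edges, such that every half-edge and every end point is an end of exactly one edge, and every edge is either an interval (with exactly two ends) or a circle (with none). Graphs are taken up to isomorphism fixing the end points; neither an orientation of the edges nor an order of the half-edges at a vertex is part of the data. Let \(\mathcal G(p,q)\) be the \(k\)-vector space with basis the isomorphism classes of graphs of type \((p,q)\) all of whose vertices have valence at least \(r_0\). (For \(r_0=1\) these are the graphs without isolated vertices, for \(r_0=0\) all graphs.) These spaces are the Hom-spaces of a linear symmetric PROP \(\mathcal G\) over \(\mathbb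 N\): composition \(\Phi\circ\Gamma\) glues the outgoing end points of \(\Gamma\) to the ingoing end points of \(\Phi\), in order, merging the edges that meet there; the tensor product is juxtaposition; the identity of \(n\) is given by \(n\) parallel strands; and the symmetry of \((m,n)\) is the crossing of a block of \(m\) strands with a block of \(n\) strands. A *\(\mathcal G\)-algebra structure* on \(V\) is a morphism \(Z\) of linear symmetric PROPs from \(\mathcal G\) to the endomorphism PROP of \(V\), i.e. a family of linear maps \(Z\colon\mathcal G(p,q)\to\operatorname{Hom}(V^{\otimes p},V^{\otimes q})\), for \(p,q\ge 0\), compatible with compositions, tensor products, identities and symmetries. Then symmetric algebra structures on \(V\) and \(\mathcal G\)-algebra structures on \(V\) are equivalent data: there is a bijection \(Z\mapsto(b,(S_r)_{r\ge r_0})\) from the set of \(\mathcal G\)-algebra structures on \(V\) onto the set of symmetric algebra structures on \(V\), where \(b\) is the value of \(Z\) on the graph of type \((2,0)\) that is a single edge joining the two end points, and \(S_r\) is the value of \(Z\) on the graph of type \((r,0)\) with a single vertex, of valence \(r\), joined by \(r\) edges to the \(r\) end points. In particular, for a fixed non-degenerate symmetric form \(b\), the families \((S_r)_{r\ge r_0}\)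 of symmetric maps correspond bijectively to the \(\mathcal G\)-algebra structures on \(V\) whose value on that edge is \(b\). -/

import Mathlib

open scoped TensorProduct

universe u v

namespace GraphProp

/-- The gluing relation generated by two families of points `s m ∼ t m`. -/
inductive Glue {M C : Type} (s t : M → C) : C → C → Prop
  | mk (m : M) : Glue s t (s m) (t m)

theorem card_fibre_le {M C : Type} [Finite M] [Finite C] (s t : M → C) (K : Quot (Glue s t)) :
    Nat.card {c // Quot.mk (Glue s t) c = K} ≤
      Nat.card {m // Quot.mk (Glue s t) (s m) = K} + 1 := by
  classical
  let N := {c // Quot.mk (Glue s t) c = K}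
  let G : SimpleGraph N := SimpleGraph.fromRel
    (fun a b => ∃ m, s m = a.1 ∧ t m = b.1)
  have key : ∀ a b : C, Relation.EqvGen (Glue s t) a b → ∀ (ha : Quot.mk (Glue s t) a = K)
      (hb : Quot.mk (Glue s t) b = K), G.Reachable ⟨a, ha⟩ ⟨b, hb⟩ := by
    intro a b h
    induction h with
    | rel x y h =>
      intro ha hb
      by_cases hxy : x = y
      · subst hxy; exact SimpleGraph.Reachable.refl _
      · cases h with
        | mk m =>
          apply SimpleGraph.Adj.reachable
          rw [SimpleGraph.fromRel_adj]
          exact ⟨fun h => hxy (congrArg Subtype.val h), Or.inl ⟨m, rfl, rfl⟩⟩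
    | refl x => intro _ _; exact SimpleGraph.Reachable.refl _
    | symm x y _ ih => intro ha hb; exact (ih hb ha).symm
    | trans x y z h1 _ ih1 ih2 =>
      intro ha hc
      have hb : Quot.mk (Glue s t) y = K := by rw [← ha]; exact (Quot.eqvGen_sound h1).symm
      exact (ih1 ha hb).trans (ih2 hb hc)
  have hne : Nonempty N := by
    obtain ⟨c, hc⟩ := Quot.exists_rep K
    exact ⟨⟨c, hc⟩⟩
  have hG : G.Connected := by
    have := hne
    refine SimpleGraph.Connected.mk ?_
    rintro ⟨a, ha⟩ ⟨b, hb⟩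
    exact key a b (Quot.eqvGen_exact (ha.trans hb.symm)) ha hb
  have h1 := hG.card_vert_le_card_edgeSet_add_one
  have h2 : Nat.card G.edgeSet ≤ Nat.card {m // Quot.mk (Glue s t) (s m) = K} := by
    let D := {m // Quot.mk (Glue s t) (s m) = K}
    have ht : ∀ m : D, Quot.mk (Glue s t) (t m.1) = K := fun m =>
      (Quot.sound (Glue.mk m.1)).symm.trans m.2
    have hex : ∀ e : G.edgeSet, ∃ m : D, e.1 = s(⟨s m.1, m.2⟩, ⟨t m.1, ht m⟩) := by
      rintro ⟨e, he⟩
      induction e with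
      | _ a b =>
        rw [SimpleGraph.mem_edgeSet, SimpleGraph.fromRel_adj] at he
        obtain ⟨_, ⟨m, h1, h2⟩ | ⟨m, h1, h2⟩⟩ := he
        · refine ⟨⟨m, by rw [h1]; exact a.2⟩, ?_⟩
          simp [h1, h2]
        · refine ⟨⟨m, by rw [h1]; exact b.2⟩, ?_⟩
          simp [h1, h2, Sym2.eq_swap]
    choose f hf using hex
    refine Nat.card_le_card_of_injective f ?_
    intro e e' h
    apply Subtype.ext
    rw [hf e, hf e', h]
  exact h1.trans (by omega)

theorem card_fibre_sum {X C : Type} [Finite X] [Fintype C] (f : X → C) (P : C → Prop)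
    [DecidablePred P] :
    Nat.card {x // P (f x)} = ∑ c with P c, Nat.card {x // f x = c} := by
  classical
  have := Fintype.ofFinite X
  simp only [Nat.card_eq_fintype_card, Fintype.card_subtype]
  rw [Finset.card_eq_sum_card_fiberwise (f := f) (t := Finset.univ.filter P)]
  · refine Finset.sum_congr rfl fun c hc => ?_
    congr 1
    ext x
    simp only [Finset.mem_filter, Finset.mem_univ, true_and] at hc ⊢
    exact ⟨fun h => h.2, fun h => ⟨h ▸ hc, h⟩⟩
  · intro x hx
    simpa using hx

/-- Gluing intervals and circles along end points gives intervals and circles. -/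
theorem card_glue {X M C : Type} [Finite X] [Finite M] [Finite C] (f : X → C) (s t : M → C)
    (h : ∀ c, Nat.card {x // Sum.elim f (Sum.elim s t) x = c} = 0 ∨
      Nat.card {x // Sum.elim f (Sum.elim s t) x = c} = 2) (K : Quot (Glue s t)) :
    Nat.card {x // Quot.mk (Glue s t) (f x) = K} = 0 ∨
      Nat.card {x // Quot.mk (Glue s t) (f x) = K} = 2 := by
  classical
  have := Fintype.ofFinite C
  have h1 := card_fibre_le s t K
  have h2 := card_fibre_sum (Sum.elim f (Sum.elim s t)) (fun c => Quot.mk (Glue s t) c = K)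
  have h3 : Nat.card {x // Quot.mk (Glue s t) (Sum.elim f (Sum.elim s t) x) = K} =
      Nat.card {x // Quot.mk (Glue s t) (f x) = K} +
        2 * Nat.card {m // Quot.mk (Glue s t) (s m) = K} := by
    have e1 := Nat.card_congr
      (Equiv.subtypeSum (p := fun x => Quot.mk (Glue s t) (Sum.elim f (Sum.elim s t) x) = K))
    have e2 := Nat.card_congr (Equiv.subtypeSum
      (p := fun x => Quot.mk (Glue s t) (Sum.elim f (Sum.elim s t) (Sum.inr x)) = K))
    have e3 : Nat.card {m // Quot.mk (Glue s t) (t m) = K} =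
        Nat.card {m // Quot.mk (Glue s t) (s m) = K} :=
      Nat.card_congr (Equiv.subtypeEquivRight fun m => by rw [Quot.sound (Glue.mk (s := s) (t := t) m)])
    rw [Nat.card_sum] at e1 e2
    simp only [Sum.elim_inl, Sum.elim_inr] at e1 e2
    omega
  have h4 : (∑ c with Quot.mk (Glue s t) c = K,
      Nat.card {x // Sum.elim f (Sum.elim s t) x = c}) ≤
        2 * Nat.card {c // Quot.mk (Glue s t) c = K} := by
    rw [Nat.card_eq_fintype_card, Fintype.card_subtype, mul_comm, ← smul_eq_mul]
    refine Finset.sum_le_card_nsmul _ _ _ fun c _ => ?_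
    rcases h c with h | h <;> omega
  have h5 : 2 ∣ ∑ c with Quot.mk (Glue s t) c = K,
      Nat.card {x // Sum.elim f (Sum.elim s t) x = c} := by
    refine Finset.dvd_sum fun c _ => ?_
    rcases h c with h | h <;> simp [h]
  rw [← h2, h3] at h4 h5
  omega

/-- An (ordinary) graph of type `(p, q)` all of whose vertices have valence at least `r₀`, up to
homeomorphism relative to its vertices and end points: a finite set `V` of vertices, a finite set
`H` of half-edges stemming from the vertices, `p` ingoing and `q` outgoing end points, and the
finite set `E` of edges. Each of the half-edges and of the end points is an end of exactly one
edge, and an edge is either an interval, with exactly two ends, or a circle, with none.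
No orientation of edges and no ordering of the half-edges at a vertex is recorded. -/
structure TypedGraph (r₀ p q : ℕ) where
  V : Type
  H : Type
  E : Type
  [finV : Finite V]
  [finH : Finite H]
  [finE : Finite E]
  /-- the vertex from which a half-edge stems -/
  vert : H → V
  /-- the edge starting at an ingoing end point -/
  src : Fin p → E
  /-- the edge ending at an outgoing end point -/
  tgt : Fin q → E
  /-- the edge to which a half-edge belongs -/
  leg : H → E
  two_ends : ∀ e : E, Nat.card {x // Sum.elim src (Sum.elim tgt leg) x = e} = 0 ∨
    Nat.card {x // Sum.elim src (Sum.elim tgt leg) x = e} = 2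
  valence : ∀ v : V, r₀ ≤ Nat.card {h // vert h = v}

attribute [instance] TypedGraph.finV TypedGraph.finH TypedGraph.finE

namespace TypedGraph

variable {r₀ p q r p' q' : ℕ}

/-- Isomorphisms of graphs of type `(p, q)`; they fix the end points. -/
structure Iso (Γ Γ' : TypedGraph r₀ p q) where
  eV : Γ.V ≃ Γ'.V
  eH : Γ.H ≃ Γ'.H
  eE : Γ.E ≃ Γ'.E
  vert : ∀ h, Γ'.vert (eH h) = eV (Γ.vert h)
  leg : ∀ h, Γ'.leg (eH h) = eE (Γ.leg h)
  src : ∀ i, Γ'.src i = eE (Γ.src i)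
  tgt : ∀ j, Γ'.tgt j = eE (Γ.tgt j)

instance setoid (r₀ p q : ℕ) : Setoid (TypedGraph r₀ p q) where
  r Γ Γ' := Nonempty (Iso Γ Γ')
  iseqv :=
    { refl := fun _ => ⟨⟨Equiv.refl _, Equiv.refl _, Equiv.refl _, fun _ => rfl, fun _ => rfl,
        fun _ => rfl, fun _ => rfl⟩⟩
      symm := by
        rintro Γ Γ' ⟨f⟩
        refine ⟨⟨f.eV.symm, f.eH.symm, f.eE.symm, fun h => ?_, fun h => ?_, fun i => ?_,
          fun j => ?_⟩⟩
        · rw [Equiv.eq_symm_apply, ← f.vert, Equiv.apply_symm_apply]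
        · rw [Equiv.eq_symm_apply, ← f.leg, Equiv.apply_symm_apply]
        · rw [Equiv.eq_symm_apply, ← f.src]
        · rw [Equiv.eq_symm_apply, ← f.tgt]
      trans := by
        rintro Γ Γ' Γ'' ⟨f⟩ ⟨g⟩
        exact ⟨⟨f.eV.trans g.eV, f.eH.trans g.eH, f.eE.trans g.eE,
          fun h => by simp [g.vert, f.vert], fun h => by simp [g.leg, f.leg],
          fun i => by simp [g.src, f.src], fun j => by simp [g.tgt, f.tgt]⟩⟩ }

theorem card_sum_map {H H' V V' : Type} [Finite H] [Finite H'] (f : H → V) (g : H' → V')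
    {n : ℕ} (hf : ∀ v, n ≤ Nat.card {h // f h = v}) (hg : ∀ v, n ≤ Nat.card {h // g h = v})
    (v : V ⊕ V') : n ≤ Nat.card {h // Sum.map f g h = v} := by
  cases v with
  | inl v =>
    refine (hf v).trans (Nat.card_le_card_of_injective
      (fun h => ⟨Sum.inl h.1, by simp [h.2]⟩) fun a b h => ?_)
    exact Subtype.ext (Sum.inl_injective (congrArg Subtype.val h))
  | inr v =>
    refine (hg v).trans (Nat.card_le_card_of_injective
      (fun h => ⟨Sum.inr h.1, by simp [h.2]⟩) fun a b h => ?_)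
    exact Subtype.ext (Sum.inr_injective (congrArg Subtype.val h))

/-- If two maps have fibres of cardinality 0 or 2, so has their disjoint union. -/
theorem card_sum_sum {X Y Z C D : Type} [Finite X] [Finite Y] (f : X → C) (g : Y → D)
    (e : Z ≃ X ⊕ Y) (k : Z → C ⊕ D) (hk : ∀ z, k z = Sum.map f g (e z))
    (hf : ∀ c, Nat.card {x // f x = c} = 0 ∨ Nat.card {x // f x = c} = 2)
    (hg : ∀ d, Nat.card {y // g y = d} = 0 ∨ Nat.card {y // g y = d} = 2) (c : C ⊕ D) :
    Nat.card {z // k z = c} = 0 ∨ Nat.card {z // k z = c} = 2 := by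
  have h1 : Nat.card {z // k z = c} = Nat.card {x // Sum.map f g x = c} :=
    Nat.card_congr (e.subtypeEquiv fun z => by rw [hk])
  have h2 := Nat.card_congr (Equiv.subtypeSum (p := fun x => Sum.map f g x = c))
  rw [Nat.card_sum] at h2
  rw [h1, h2]
  cases c with
  | inl c => simpa using hf c
  | inr d => simpa using hg d

/-- The composition `Φ ∘ Γ`: the `i`-th outgoing end point of `Γ` is glued to the `i`-th ingoing
end point of `Φ`, for each `i`; the two edges that meet there are merged into one. -/
def comp (Φ : TypedGraph r₀ q r) (Γ : TypedGraph r₀ p q) : TypedGraph r₀ p r where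
  V := Γ.V ⊕ Φ.V
  H := Γ.H ⊕ Φ.H
  E := Quot (Glue (fun i => (Sum.inl (Γ.tgt i) : Γ.E ⊕ Φ.E)) (fun i => Sum.inr (Φ.src i)))
  vert := Sum.map Γ.vert Φ.vert
  src i := Quot.mk _ (Sum.inl (Γ.src i))
  tgt j := Quot.mk _ (Sum.inr (Φ.tgt j))
  leg h := Quot.mk _ (Sum.map Γ.leg Φ.leg h)
  two_ends := by
    intro K
    have h := card_glue
      (Sum.elim (fun i => (Sum.inl (Γ.src i) : Γ.E ⊕ Φ.E))
        (Sum.elim (fun j => Sum.inr (Φ.tgt j)) (Sum.map Γ.leg Φ.leg)))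
      (fun i => (Sum.inl (Γ.tgt i) : Γ.E ⊕ Φ.E)) (fun i => Sum.inr (Φ.src i))
      (card_sum_sum (Sum.elim Γ.src (Sum.elim Γ.tgt Γ.leg))
        (Sum.elim Φ.src (Sum.elim Φ.tgt Φ.leg))
        { toFun := Sum.elim (Sum.elim (fun i => Sum.inl (Sum.inl i)) (Sum.elim
            (fun j => Sum.inr (Sum.inr (Sum.inl j)))
            (Sum.elim (fun h => Sum.inl (Sum.inr (Sum.inr h)))
              (fun h => Sum.inr (Sum.inr (Sum.inr h))))))
            (Sum.elim (fun i => Sum.inl (Sum.inr (Sum.inl i))) (fun i => Sum.inr (Sum.inl i)))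
          invFun := Sum.elim
            (Sum.elim (fun i => Sum.inl (Sum.inl i)) (Sum.elim (fun i => Sum.inr (Sum.inl i))
              (fun h => Sum.inl (Sum.inr (Sum.inr (Sum.inl h))))))
            (Sum.elim (fun i => Sum.inr (Sum.inr i)) (Sum.elim
              (fun j => Sum.inl (Sum.inr (Sum.inl j)))
              (fun h => Sum.inl (Sum.inr (Sum.inr (Sum.inr h))))))
          left_inv := by rintro ((i | j | h | h) | i | i) <;> rfl
          right_inv := by rintro ((i | i | h) | i | j | h) <;> rfl }
        _ (by rintro ((i | j | h | h) | i | i) <;> rfl) Γ.two_ends Φ.two_ends) K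
    have e : ∀ x : Fin p ⊕ Fin r ⊕ Γ.H ⊕ Φ.H,
        Sum.elim (fun i => Quot.mk (Glue (fun i => (Sum.inl (Γ.tgt i) : Γ.E ⊕ Φ.E))
            (fun i => Sum.inr (Φ.src i))) (Sum.inl (Γ.src i)))
          (Sum.elim (fun j => Quot.mk _ (Sum.inr (Φ.tgt j)))
            (fun h => Quot.mk _ (Sum.map Γ.leg Φ.leg h))) x =
        Quot.mk _ (Sum.elim (fun i => (Sum.inl (Γ.src i) : Γ.E ⊕ Φ.E))
          (Sum.elim (fun j => Sum.inr (Φ.tgt j)) (Sum.map Γ.leg Φ.leg)) x) := by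
      rintro (i | j | h) <;> rfl
    simp only [e]
    exact h
  valence := card_sum_map _ _ Γ.valence Φ.valence

/-- The tensor product `Γ ⊗ Φ`: juxtaposition, the end points of `Γ` preceding those of `Φ`. -/
def tensor (Γ : TypedGraph r₀ p q) (Φ : TypedGraph r₀ p' q') :
    TypedGraph r₀ (p + p') (q + q') where
  V := Γ.V ⊕ Φ.V
  H := Γ.H ⊕ Φ.H
  E := Γ.E ⊕ Φ.E
  vert := Sum.map Γ.vert Φ.vert
  src i := Sum.map Γ.src Φ.src (finSumFinEquiv.symm i)
  tgt j := Sum.map Γ.tgt Φ.tgt (finSumFinEquiv.symm j)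
  leg := Sum.map Γ.leg Φ.leg
  two_ends := card_sum_sum (Sum.elim Γ.src (Sum.elim Γ.tgt Γ.leg))
    (Sum.elim Φ.src (Sum.elim Φ.tgt Φ.leg))
    ((Equiv.sumCongr finSumFinEquiv.symm (Equiv.sumCongr finSumFinEquiv.symm
        (Equiv.refl _))).trans
      { toFun := Sum.elim (Sum.elim (fun i => Sum.inl (Sum.inl i)) (fun i => Sum.inr (Sum.inl i)))
          (Sum.elim (Sum.elim (fun j => Sum.inl (Sum.inr (Sum.inl j)))
              (fun j => Sum.inr (Sum.inr (Sum.inl j))))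
            (Sum.elim (fun h => Sum.inl (Sum.inr (Sum.inr h)))
              (fun h => Sum.inr (Sum.inr (Sum.inr h)))))
        invFun := Sum.elim
          (Sum.elim (fun i => Sum.inl (Sum.inl i)) (Sum.elim
            (fun j => Sum.inr (Sum.inl (Sum.inl j))) (fun h => Sum.inr (Sum.inr (Sum.inl h)))))
          (Sum.elim (fun i => Sum.inl (Sum.inr i)) (Sum.elim
            (fun j => Sum.inr (Sum.inl (Sum.inr j))) (fun h => Sum.inr (Sum.inr (Sum.inr h)))))
        left_inv := by rintro ((i | i) | (j | j) | h | h) <;> rfl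
        right_inv := by rintro ((i | i | h) | i | j | h) <;> rfl })
    _ (by
      rintro (i | j | h)
      · simp only [Sum.elim_inl, Equiv.trans_apply, Equiv.sumCongr_apply, Sum.map_inl]
        cases finSumFinEquiv.symm i <;> rfl
      · simp only [Sum.elim_inr, Sum.elim_inl, Equiv.trans_apply, Equiv.sumCongr_apply,
          Sum.map_inr, Sum.map_inl]
        cases finSumFinEquiv.symm j <;> rfl
      · cases h <;> rfl) Γ.two_ends Φ.two_ends
  valence := card_sum_map _ _ Γ.valence Φ.valence

/-- The graph without vertices whose `j`-th outgoing end point is joined by a strand to the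
`e.symm j`-th ingoing one. -/
def strands (r₀ : ℕ) {m n : ℕ} (e : Fin m ≃ Fin n) : TypedGraph r₀ m n where
  V := Empty
  H := Empty
  E := Fin m
  vert := Empty.elim
  src i := i
  tgt j := e.symm j
  leg := Empty.elim
  two_ends := by
    intro i
    right
    rw [Nat.card_congr (Equiv.subtypeSum
        (p := fun x => Sum.elim (fun i => i) (Sum.elim (fun j => e.symm j) Empty.elim) x = i)),
      Nat.card_sum, Nat.card_congr (Equiv.subtypeSum (p := fun x => Sum.elim (fun i => i)
        (Sum.elim (fun j => e.symm j) Empty.elim) (Sum.inr x) = i)), Nat.card_sum]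
    simp [Equiv.symm_apply_eq]
  valence v := v.elim

/-- The identity graph: `n` parallel strands. -/
def id (r₀ n : ℕ) : TypedGraph r₀ n n := strands r₀ (Equiv.refl (Fin n))

/-- The symmetry: the block of the first `m` strands crosses the block of the last `n` ones. -/
def braiding (r₀ m n : ℕ) : TypedGraph r₀ (m + n) (n + m) := strands r₀ finAddFlip

/-- The graph of type `(2, 0)` with no vertices and a single edge joining its end points. -/
def cap (r₀ : ℕ) : TypedGraph r₀ 2 0 where
  V := Empty
  H := Empty
  E := Unit
  vert := Empty.elim
  src _ := ()
  tgt := Fin.elim0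
  leg := Empty.elim
  two_ends := by
    intro e
    right
    have : ∀ x : Fin 2 ⊕ Fin 0 ⊕ Empty,
      Sum.elim (fun _ => ()) (Sum.elim Fin.elim0 Empty.elim) x = e := fun x => rfl
    rw [Nat.card_congr (Equiv.subtypeUnivEquiv this)]
    simp
  valence v := v.elim

/-- The graph of type `(r, 0)` with one vertex, of valence `r`, and `r` edges, joining that vertex
to the end points. -/
def corolla (r₀ r : ℕ) (hr : r₀ ≤ r) : TypedGraph r₀ r 0 where
  V := Unit
  H := Fin r
  E := Fin r
  vert _ := ()
  src i := i
  tgt := Fin.elim0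
  leg h := h
  two_ends := by
    intro i
    right
    rw [Nat.card_congr (Equiv.subtypeSum
        (p := fun x => Sum.elim (fun i => i) (Sum.elim Fin.elim0 (fun h => h)) x = i)),
      Nat.card_sum, Nat.card_congr (Equiv.subtypeSum (p := fun x => Sum.elim (fun i => i)
        (Sum.elim Fin.elim0 (fun h => h)) (Sum.inr x) = i)), Nat.card_sum]
    simp
  valence _ := by
    rw [Nat.card_congr (Equiv.subtypeUnivEquiv fun _ => rfl)]
    simpa using hr

theorem comp_congr {Φ Φ' : TypedGraph r₀ q r} {Γ Γ' : TypedGraph r₀ p q} (h : Φ ≈ Φ')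
    (h' : Γ ≈ Γ') : comp Φ Γ ≈ comp Φ' Γ' := by
  obtain ⟨f⟩ := h
  obtain ⟨g⟩ := h'
  refine ⟨⟨Equiv.sumCongr g.eV f.eV, Equiv.sumCongr g.eH f.eH,
    Quot.congr (Equiv.sumCongr g.eE f.eE) fun a b => ⟨?_, ?_⟩, ?_, ?_, ?_, ?_⟩⟩
  · rintro ⟨i⟩
    have := Glue.mk (s := fun i => (Sum.inl (Γ'.tgt i) : Γ'.E ⊕ Φ'.E))
      (t := fun i => Sum.inr (Φ'.src i)) i
    simpa [g.tgt, f.src] using this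
  · generalize ha : (Equiv.sumCongr g.eE f.eE) a = a'
    generalize hb : (Equiv.sumCongr g.eE f.eE) b = b'
    rintro ⟨i⟩
    rw [← Equiv.eq_symm_apply] at ha hb
    have := Glue.mk (s := fun i => (Sum.inl (Γ.tgt i) : Γ.E ⊕ Φ.E))
      (t := fun i => Sum.inr (Φ.src i)) i
    simpa [ha, hb, g.tgt, f.src] using this
  · rintro (h | h)
    · exact congrArg Sum.inl (g.vert h)
    · exact congrArg Sum.inr (f.vert h)
  · rintro (h | h)
    · exact congrArg (fun e => Quot.mk _ (Sum.inl e)) (g.leg h)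
    · exact congrArg (fun e => Quot.mk _ (Sum.inr e)) (f.leg h)
  · exact fun i => congrArg (fun e => Quot.mk _ (Sum.inl e)) (g.src i)
  · exact fun j => congrArg (fun e => Quot.mk _ (Sum.inr e)) (f.tgt j)

theorem tensor_congr {Γ Γ' : TypedGraph r₀ p q} {Φ Φ' : TypedGraph r₀ p' q'} (h : Γ ≈ Γ')
    (h' : Φ ≈ Φ') : tensor Γ Φ ≈ tensor Γ' Φ' := by
  obtain ⟨g⟩ := h
  obtain ⟨f⟩ := h'
  refine ⟨⟨Equiv.sumCongr g.eV f.eV, Equiv.sumCongr g.eH f.eH, Equiv.sumCongr g.eE f.eE,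
    ?_, ?_, ?_, ?_⟩⟩
  · rintro (h | h)
    · exact congrArg Sum.inl (g.vert h)
    · exact congrArg Sum.inr (f.vert h)
  · rintro (h | h)
    · exact congrArg Sum.inl (g.leg h)
    · exact congrArg Sum.inr (f.leg h)
  · intro i
    simp only [tensor]
    rcases finSumFinEquiv.symm i with i | i
    · exact congrArg Sum.inl (g.src i)
    · exact congrArg Sum.inr (f.src i)
  · intro i
    simp only [tensor]
    rcases finSumFinEquiv.symm i with i | i
    · exact congrArg Sum.inl (g.tgt i)
    · exact congrArg Sum.inr (f.tgt i)

end TypedGraph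

/-- Isomorphism classes of graphs of type `(p, q)`. -/
abbrev GraphClass (r₀ p q : ℕ) : Type 1 := Quotient (TypedGraph.setoid r₀ p q)

namespace GraphClass

/-- The isomorphism class of a graph. -/
def mk {r₀ p q : ℕ} (Γ : TypedGraph r₀ p q) : GraphClass r₀ p q := Quotient.mk _ Γ

def comp {r₀ p q r : ℕ} : GraphClass r₀ q r → GraphClass r₀ p q → GraphClass r₀ p r :=
  Quotient.map₂ TypedGraph.comp fun _ _ h _ _ h' => TypedGraph.comp_congr h h'

def tensor {r₀ p q p' q' : ℕ} :
    GraphClass r₀ p q → GraphClass r₀ p' q' → GraphClass r₀ (p + p') (q + q') :=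
  Quotient.map₂ TypedGraph.tensor fun _ _ h _ _ h' => TypedGraph.tensor_congr h h'

end GraphClass

/-- The hom-space `CG(p, q)`: the linear span of the graphs of type `(p, q)`. -/
abbrev CG (k : Type u) [Field k] (r₀ p q : ℕ) : Type (max u 1) := GraphClass r₀ p q →₀ k

namespace CG

variable (k : Type u) [Field k] {r₀ : ℕ}

/-- A graph, as a basis element of the hom-space. -/
noncomputable def of {p q : ℕ} (Γ : TypedGraph r₀ p q) : CG k r₀ p q :=
  Finsupp.single (GraphClass.mk Γ) 1

/-- The bilinear extension of the composition of graphs. -/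
noncomputable def comp {p q r : ℕ} : CG k r₀ q r →ₗ[k] CG k r₀ p q →ₗ[k] CG k r₀ p r :=
  Finsupp.linearCombination k fun Φ => Finsupp.lmapDomain k k (GraphClass.comp Φ)

/-- The bilinear extension of the tensor product of graphs. -/
noncomputable def tensor {p q p' q' : ℕ} :
    CG k r₀ p q →ₗ[k] CG k r₀ p' q' →ₗ[k] CG k r₀ (p + p') (q + q') :=
  Finsupp.linearCombination k fun Γ => Finsupp.lmapDomain k k (GraphClass.tensor Γ)

end CG

section

variable (k : Type u) [Field k] (V : Type v) [AddCommGroup V] [Module k V]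

/-- The hom-spaces `Hom(V^{⊗ m}, V^{⊗ n})` of the endomorphism PROP of `V`. -/
abbrev EndProp (m n : ℕ) : Type (max u v) := (⨂[k]^m V) →ₗ[k] (⨂[k]^n V)

/-- The tensor product of linear maps, through `V^{⊗ m} ⊗ V^{⊗ m'} ≃ V^{⊗ (m + m')}`. -/
noncomputable def EndProp.tensor {m n m' n' : ℕ} (f : EndProp k V m n) (g : EndProp k V m' n') :
    EndProp k V (m + m') (n + n') :=
  TensorPower.mulEquiv.toLinearMap ∘ₗ TensorProduct.map f g ∘ₗ
    TensorPower.mulEquiv.symm.toLinearMap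

/-- The symmetry `V^{⊗ m} ⊗ V^{⊗ n} → V^{⊗ n} ⊗ V^{⊗ m}`, `x ⊗ y ↦ y ⊗ x`. -/
noncomputable def EndProp.braiding (m n : ℕ) : EndProp k V (m + n) (n + m) :=
  (PiTensorProduct.reindex k (fun _ => V) (finAddFlip : Fin (m + n) ≃ Fin (n + m))).toLinearMap

/-- An algebra structure on `V` over the PROP of graphs with vertices of valence at least `r₀`: a
morphism of linear symmetric PROPs from it to the endomorphism PROP of `V`. -/
@[ext]
structure CGAlgebra (r₀ : ℕ) where
  toMap : ∀ p q : ℕ, CG k r₀ p q →ₗ[k] EndProp k V p q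
  map_comp : ∀ {p q r : ℕ} (Φ : CG k r₀ q r) (Γ : CG k r₀ p q),
    toMap p r (CG.comp k Φ Γ) = toMap q r Φ ∘ₗ toMap p q Γ
  map_tensor : ∀ {p q p' q' : ℕ} (Γ : CG k r₀ p q) (Φ : CG k r₀ p' q'),
    toMap (p + p') (q + q') (CG.tensor k Γ Φ) =
      EndProp.tensor k V (toMap p q Γ) (toMap p' q' Φ)
  map_id : ∀ n : ℕ, toMap n n (CG.of k (TypedGraph.id r₀ n)) = LinearMap.id
  map_braiding : ∀ m n : ℕ,
    toMap (m + n) (n + m) (CG.of k (TypedGraph.braiding r₀ m n)) = EndProp.braiding k V m n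

/-- A symmetric algebra structure on `V`: a non-degenerate symmetric inner product and a sequence
of linear maps `S r : V^{⊗ r} → k`, for `r ≥ r₀`, invariant under the symmetric groups. -/
@[ext]
structure SymmetricAlgebraStructure (r₀ : ℕ) where
  b : LinearMap.BilinForm k V
  b_symm : b.IsSymm
  b_nondegenerate : b.Nondegenerate
  S : ∀ r : ℕ, r₀ ≤ r → (⨂[k]^r V) →ₗ[k] k
  S_symm : ∀ (r : ℕ) (hr : r₀ ≤ r) (σ : Equiv.Perm (Fin r)) (X : Fin r → V),
    S r hr (PiTensorProduct.tprod k X) = S r hr (PiTensorProduct.tprod k fun i => X (σ i))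

variable {k V}

/-- The operator of a graph of type `(p, 0)`, as a linear form, through `V^{⊗ 0} = k`. -/
noncomputable def CGAlgebra.functional {r₀ p : ℕ} (Z : CGAlgebra k V r₀)
    (Γ : TypedGraph r₀ p 0) : (⨂[k]^p V) →ₗ[k] k :=
  (PiTensorProduct.isEmptyEquiv (Fin 0)).toLinearMap ∘ₗ Z.toMap p 0 (CG.of k Γ)

end

end GraphProp

namespace GraphProp

/-! A basis of `V` turns a PROP morphism into a family of matrices indexed by colourings of the end
points (`IsMatrixProp`), and both halves of the bijection are proved for such matrices.

Uniqueness: every graph arises by composition and juxtaposition from strands, the two arcs `cap` and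
`cup`, and corollas (`generated`). Vertices are split off one by one, then the edges of the
vertex-free remainder; a circle is `cap` after `cup`. Values on strands are forced by the identities
and symmetries (`strands_apply`). The snake identity makes the matrices of `cap` and `cup` mutually
inverse, so `b` is non-degenerate and already determines the value on `cup`. Edges have no
orientation and half-edges no order, so permuting the inputs of `cap` or of a corolla returns the
same graph; hence `b` and the `S r` are symmetric.

Existence: the value of a graph is defined directly as a state sum, so no presentation of the PROP
by generators and relations is needed. Half-edges are coloured by basis indices. A vertex
contributes `S r` of the basis vectors at its half-edges. An edge contributes `b` of the vectors at
its two ends: basis vectors at ingoing end points, dual basis vectors at outgoing end points and at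
half-edges. A circle contributes the sum of `b (d i) (e i)`. Symmetry of `b` and `S r` makes this
independent of all choices.

The substantial point is compatibility with composition. Summing over the colour at a glued point
uses `∑ i, b x (d i) * b (e i) y = b x y` when two different edges meet, and yields the circle
weight when an edge closes up (`sum_edgesWeight_glue_pair`, iterated in `sum_edgesWeight_glue`). On
`cap` and the corollas the state sum returns `b` and `S r`. -/

theorem card_fibre_congr {X Y C D : Type} (e : X ≃ Y) {f : X → C} {g : Y → D} {c : C} {d : D}
    (h : ∀ x, f x = c ↔ g (e x) = d) :
    Nat.card {x // f x = c} = Nat.card {y // g y = d} :=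
  Nat.card_congr (e.subtypeEquiv h)

/-! ### Elementary graphs and the relations between them -/

namespace TypedGraph

variable {r₀ p q r p' q' : ℕ}

/-- A criterion for a graph to be a composition of two others. -/
theorem comp_equiv_of {Φ : TypedGraph r₀ q r} {Γ : TypedGraph r₀ p q} {Δ : TypedGraph r₀ p r}
    (eV : Γ.V ⊕ Φ.V ≃ Δ.V) (eH : Γ.H ⊕ Φ.H ≃ Δ.H) (f : Γ.E → Δ.E) (g : Φ.E → Δ.E)
    (hfg : ∀ i, f (Γ.tgt i) = g (Φ.src i)) (s : Δ.E → Γ.E ⊕ Φ.E)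
    (hs : ∀ e, Sum.elim f g (s e) = e)
    (hf : ∀ e, Relation.EqvGen (Glue (fun i => (Sum.inl (Γ.tgt i) : Γ.E ⊕ Φ.E))
      (fun i => Sum.inr (Φ.src i))) (s (f e)) (Sum.inl e))
    (hg : ∀ e, Relation.EqvGen (Glue (fun i => (Sum.inl (Γ.tgt i) : Γ.E ⊕ Φ.E))
      (fun i => Sum.inr (Φ.src i))) (s (g e)) (Sum.inr e))
    (hvert : ∀ h, Δ.vert (eH h) = eV (Sum.map Γ.vert Φ.vert h))
    (hleg : ∀ h, Δ.leg (eH h) = Sum.elim f g (Sum.map Γ.leg Φ.leg h))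
    (hsrc : ∀ i, Δ.src i = f (Γ.src i)) (htgt : ∀ j, Δ.tgt j = g (Φ.tgt j)) :
    comp Φ Γ ≈ Δ := by
  let R := Glue (fun i => (Sum.inl (Γ.tgt i) : Γ.E ⊕ Φ.E)) (fun i => Sum.inr (Φ.src i))
  -- `s` chooses one unglued edge inside each edge of `Δ`. By `hf` and `hg` every unglued edge is
  -- linked to the chosen one, so the fibres of `Sum.elim f g` are exactly the gluing classes.
  let eE : Quot R ≃ Δ.E :=
    { toFun := Quot.lift (Sum.elim f g) (by rintro _ _ ⟨i⟩; exact hfg i)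
      invFun := fun e => Quot.mk _ (s e)
      left_inv := by
        rintro ⟨e | e⟩
        · exact Quot.eqvGen_sound (hf e)
        · exact Quot.eqvGen_sound (hg e)
      right_inv := hs }
  exact ⟨⟨eV, eH, eE, hvert, hleg, hsrc, htgt⟩⟩

/-- The graph `Γ` with its outgoing end points renumbered. -/
theorem comp_strands_left {q' : ℕ} (e : Fin q ≃ Fin q') {Γ : TypedGraph r₀ p q}
    {Δ : TypedGraph r₀ p q'} (eV : Γ.V ≃ Δ.V) (eH : Γ.H ≃ Δ.H) (eE : Γ.E ≃ Δ.E)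
    (hvert : ∀ h, Δ.vert (eH h) = eV (Γ.vert h)) (hleg : ∀ h, Δ.leg (eH h) = eE (Γ.leg h))
    (hsrc : ∀ i, Δ.src i = eE (Γ.src i)) (htgt : ∀ j, Δ.tgt (e j) = eE (Γ.tgt j)) :
    comp (strands r₀ e) Γ ≈ Δ := by
  refine comp_equiv_of ((Equiv.sumEmpty Γ.V Empty).trans eV)
    ((Equiv.sumEmpty Γ.H Empty).trans eH) eE
    (fun i => eE (Γ.tgt i)) (fun i => rfl) (fun x => Sum.inl (eE.symm x)) (fun x => by simp)
    (fun x => ?_) (fun x => ?_) ?_ ?_ hsrc ?_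
  · simpa using Relation.EqvGen.refl _
  · rw [Equiv.symm_apply_apply]
    exact Relation.EqvGen.rel _ _ (Glue.mk (s := fun i =>
      (Sum.inl (Γ.tgt i) : Γ.E ⊕ (strands r₀ e).E))
        (t := fun i => Sum.inr ((strands r₀ e).src i)) x)
  · rintro (h | h)
    · exact hvert h
    · exact h.elim
  · rintro (h | h)
    · exact hleg h
    · exact h.elim
  · intro j
    obtain ⟨j, rfl⟩ := e.surjective j
    rw [htgt]
    simp [strands]

/-- The graph `Γ` with its ingoing end points renumbered. -/
theorem comp_strands_right {p' : ℕ} (e : Fin p' ≃ Fin p) {Γ : TypedGraph r₀ p q}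
    {Δ : TypedGraph r₀ p' q} (eV : Γ.V ≃ Δ.V) (eH : Γ.H ≃ Δ.H) (eE : Γ.E ≃ Δ.E)
    (hvert : ∀ h, Δ.vert (eH h) = eV (Γ.vert h)) (hleg : ∀ h, Δ.leg (eH h) = eE (Γ.leg h))
    (hsrc : ∀ i, Δ.src i = eE (Γ.src (e i))) (htgt : ∀ j, Δ.tgt j = eE (Γ.tgt j)) :
    comp Γ (strands r₀ e) ≈ Δ := by
  refine comp_equiv_of ((Equiv.emptySum Empty Γ.V).trans eV) ((Equiv.emptySum Empty Γ.H).trans eH)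
    (fun i => eE (Γ.src (e i))) eE (fun i => ?_) (fun x => Sum.inr (eE.symm x)) (fun x => by simp)
    (fun x => ?_) (fun x => ?_) ?_ ?_ hsrc htgt
  · simp [strands]
  · have := (Relation.EqvGen.rel _ _ (Glue.mk (s := fun i =>
      (Sum.inl ((strands r₀ e).tgt i) : (strands r₀ e).E ⊕ Γ.E)) (t := fun i => Sum.inr (Γ.src i))
        (e x))).symm
    rw [show (strands r₀ e).tgt (e x) = x from e.symm_apply_apply x] at this
    rwa [Equiv.symm_apply_apply]
  · simpa using Relation.EqvGen.refl _
  · rintro (h | h)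
    · exact h.elim
    · exact hvert h
  · rintro (h | h)
    · exact h.elim
    · exact hleg h

theorem strands_comp {m n l : ℕ} (e : Fin m ≃ Fin n) (e' : Fin n ≃ Fin l) :
    comp (strands r₀ e') (strands r₀ e) ≈ strands r₀ (e.trans e') :=
  comp_strands_left e' (Equiv.refl _) (Equiv.refl _) (Equiv.refl _) (fun h => h.elim)
    (fun h => h.elim) (fun _ => rfl) (fun j => by simp [strands]; rfl)

/-- The graph of type `(0, 2)` with no vertices and a single edge joining its end points. -/
def cup (r₀ : ℕ) : TypedGraph r₀ 0 2 where
  V := Empty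
  H := Empty
  E := Unit
  vert := Empty.elim
  src := Fin.elim0
  tgt _ := ()
  leg := Empty.elim
  two_ends e := by
    right
    have : ∀ x : Fin 0 ⊕ Fin 2 ⊕ Empty,
      Sum.elim Fin.elim0 (Sum.elim (fun _ => ()) Empty.elim) x = e := fun x => rfl
    rw [Nat.card_congr (Equiv.subtypeUnivEquiv this)]
    simp
  valence v := v.elim

/-- The graph without end points that is a single circle. -/
def circle (r₀ : ℕ) : TypedGraph r₀ 0 0 where
  V := Empty
  H := Empty
  E := Unit
  vert := Empty.elim
  src := Fin.elim0
  tgt := Fin.elim0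
  leg := Empty.elim
  two_ends e := by left; simp
  valence v := v.elim

/-- Both gluings join the same two arcs, so the merged edge has no ends left. This makes a separate
generator for circles unnecessary. -/
theorem cap_comp_cup : comp (cap r₀) (cup r₀) ≈ circle r₀ := by
  refine comp_equiv_of (Equiv.sumEmpty Empty Empty) (Equiv.sumEmpty Empty Empty)
    (fun _ => ()) (fun _ => ())
    (fun _ => rfl) (fun _ => Sum.inl ()) (fun _ => rfl) (fun _ => Relation.EqvGen.refl _)
    (fun _ => Relation.EqvGen.rel _ _ (Glue.mk (0 : Fin 2))) ?_ ?_ (fun i => i.elim0)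
    (fun i => i.elim0)
  · rintro (h | h) <;> exact h.elim
  · rintro (h | h) <;> exact h.elim

/-- The edge carries no orientation, so its two ends may be exchanged. This is the source of the
symmetry of `b`. -/
theorem cap_comp_swap : comp (cap r₀) (strands r₀ (finAddFlip (m := 1) (n := 1))) ≈ cap r₀ :=
  comp_strands_right _ (Equiv.refl _) (Equiv.refl _) (Equiv.refl _) (fun h => h.elim)
    (fun h => h.elim) (fun _ => rfl) (fun j => j.elim0)

/-- Half-edges at a vertex are unordered, so relabelling half-edges and edges by `σ.symm` undoes the
renumbering. This is the source of the symmetry of `S r`. -/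
theorem corolla_comp_strands (hr : r₀ ≤ r) (σ : Equiv.Perm (Fin r)) :
    comp (corolla r₀ r hr) (strands r₀ σ) ≈ corolla r₀ r hr :=
  comp_strands_right σ (Equiv.refl _) σ.symm σ.symm (fun _ => rfl)
    (fun _ => rfl) (fun i => (σ.symm_apply_apply i).symm) (fun j => j.elim0)

/-- The snake identity. -/
theorem snake :
    comp (p := 1) (q := 3) (r := 1)
      (tensor (p := 2) (p' := 1) (q := 0) (q' := 1) (cap r₀) (id r₀ 1))
      (tensor (p := 1) (p' := 0) (q := 1) (q' := 2) (id r₀ 1) (cup r₀)) ≈ id r₀ 1 := by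
  -- The three gluings link the four edges in a chain: lower strand, `cap`, `cup`, upper strand.
  have h : ∀ i : Fin 3, _ := fun i => Relation.EqvGen.rel _ _ (Glue.mk
    (s := fun i => (Sum.inl ((tensor (id r₀ 1) (cup r₀)).tgt i) :
      (tensor (id r₀ 1) (cup r₀)).E ⊕ (tensor (cap r₀) (id r₀ 1)).E))
    (t := fun i => Sum.inr ((tensor (cap r₀) (id r₀ 1)).src i)) i)
  refine comp_equiv_of (Equiv.equivOfIsEmpty ((Empty ⊕ Empty) ⊕ (Empty ⊕ Empty)) Empty)
    (Equiv.equivOfIsEmpty ((Empty ⊕ Empty) ⊕ (Empty ⊕ Empty)) Empty) (fun _ => (0 : Fin 1))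
    (fun _ => (0 : Fin 1)) (fun _ => rfl) (fun _ => Sum.inl (Sum.inl (0 : Fin 1)))
    (fun e => Subsingleton.elim (α := Fin 1) _ _) ?_ ?_ ?_ ?_
    (fun i => Subsingleton.elim (α := Fin 1) _ _) (fun i => Subsingleton.elim (α := Fin 1) _ _)
  · rintro (e | e)
    · obtain rfl : e = (0 : Fin 1) := Subsingleton.elim (α := Fin 1) _ _
      exact Relation.EqvGen.refl _
    · exact ((h 0).trans _ _ _ (h 1).symm)
  · rintro (e | e)
    · exact h 0
    · obtain rfl : e = (0 : Fin 1) := Subsingleton.elim (α := Fin 1) _ _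
      exact ((h 0).trans _ _ _ (h 1).symm).trans _ _ _ (h 2)
  · rintro ((h | h) | (h | h)) <;> exact h.elim
  · rintro ((h | h) | (h | h)) <;> exact h.elim

/-! ### Decomposition of a graph into elementary ones -/

/-- The graph obtained by deleting a vertex, the half-edges at which become outgoing end points. -/
def removeVertex (Γ : TypedGraph r₀ p q) (v : Γ.V) (e : Fin r ≃ {h // Γ.vert h = v}) :
    TypedGraph r₀ p (q + r) where
  V := {w // ¬ w = v}
  H := {h // ¬ Γ.vert h = v}
  E := Γ.E
  vert h := ⟨Γ.vert h.1, h.2⟩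
  src := Γ.src
  tgt j := Sum.elim Γ.tgt (fun i => Γ.leg (e i)) (finSumFinEquiv.symm j)
  leg h := Γ.leg h.1
  two_ends x := by
    classical
    -- Each new outgoing end point takes the place of one half-edge at `v` on the same edge, so the
    -- ends of an edge are merely relabelled.
    rw [card_fibre_congr (g := Sum.elim Γ.src (Sum.elim Γ.tgt Γ.leg)) (d := x)
      ((Equiv.refl (Fin p)).sumCongr (((finSumFinEquiv.symm.trans
          ((Equiv.refl (Fin q)).sumCongr e)).sumCongr (Equiv.refl _)).trans
        ((Equiv.sumAssoc _ _ _).trans ((Equiv.refl (Fin q)).sumCongr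
          (Equiv.sumCompl (fun h => Γ.vert h = v))))))]
    · exact Γ.two_ends x
    · rintro (i | j | h)
      · rfl
      · obtain ⟨j | j, rfl⟩ := finSumFinEquiv.surjective j <;> simp
      · simp
  valence w := by
    refine (Γ.valence w.1).trans (Nat.card_congr
      { toFun := fun h => ⟨⟨h.1, fun hv => w.2 (h.2.symm.trans hv)⟩, Subtype.ext h.2⟩
        invFun := fun h => ⟨h.1.1, congrArg Subtype.val h.2⟩
        left_inv := fun _ => rfl
        right_inv := fun _ => rfl }).le

/-- Deleting the vertex keeps all edges of `Γ`. Each edge of the strands and of the corolla is glued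
to one of these, so merging absorbs it and every class has a representative of the form `Sum.inl`.
-/
theorem removeVertex_comp (Γ : TypedGraph r₀ p q) (v : Γ.V) (hr : r₀ ≤ r)
    (e : Fin r ≃ {h // Γ.vert h = v}) :
    comp (r := q + 0) (tensor (id r₀ q) (corolla r₀ r hr)) (removeVertex Γ v e) ≈ Γ := by
  classical
  refine comp_equiv_of
    ((((Equiv.refl _).sumCongr ((Equiv.emptySum Empty Unit).trans
      (Equiv.ofUnique Unit {w // w = v}))).trans (Equiv.sumComm _ _)).trans
        (Equiv.sumCompl (fun w => w = v)) : {w // ¬ w = v} ⊕ (Empty ⊕ Unit) ≃ Γ.V)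
    ((((Equiv.refl _).sumCongr ((Equiv.emptySum Empty (Fin r)).trans e)).trans
      (Equiv.sumComm _ _)).trans
        (Equiv.sumCompl (fun h => Γ.vert h = v)) :
          {h // ¬ Γ.vert h = v} ⊕ (Empty ⊕ Fin r) ≃ Γ.H)
    (fun e => e) (Sum.elim Γ.tgt (fun i : Fin r => Γ.leg (e i)) : Fin q ⊕ Fin r → Γ.E)
    ?_ Sum.inl (fun e => rfl) (fun _ => Relation.EqvGen.refl _) ?_ ?_ ?_ (fun _ => rfl) ?_
  · intro i
    obtain ⟨i | i, rfl⟩ := finSumFinEquiv.surjective i <;>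
      simp [removeVertex, tensor, corolla, id, strands]
  · intro x
    obtain ⟨i, rfl⟩ : ∃ i : Fin (q + r), finSumFinEquiv.symm i = x :=
      finSumFinEquiv.symm.surjective x
    have := Relation.EqvGen.rel _ _ (Glue.mk
      (s := fun i => (Sum.inl ((removeVertex Γ v e).tgt i) :
        (removeVertex Γ v e).E ⊕ (tensor (id r₀ q) (corolla r₀ r hr)).E))
      (t := fun i => Sum.inr ((tensor (id r₀ q) (corolla r₀ r hr)).src i)) i)
    have hi : (tensor (id r₀ q) (corolla r₀ r hr)).src i = finSumFinEquiv.symm i :=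
      congrFun Sum.map_id_id (finSumFinEquiv.symm i)
    rw [hi] at this
    exact this
  · rintro (h | h | h)
    · rfl
    · exact h.elim
    · exact (e h).2
  · rintro (h | h | h)
    · rfl
    · exact h.elim
    · rfl
  · intro j
    obtain ⟨j | j, rfl⟩ := finSumFinEquiv.surjective j
    · simp [tensor, id, strands]
      rfl
    · exact j.elim0

/-- The part of a graph without vertices that is formed by a set of edges. -/
noncomputable def restrictEdges (Γ : TypedGraph r₀ p q) [IsEmpty Γ.H] (P : Γ.E → Prop) :
    TypedGraph r₀ (Nat.card {i // P (Γ.src i)}) (Nat.card {j // P (Γ.tgt j)}) where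
  V := Empty
  H := Empty
  E := {e // P e}
  vert := Empty.elim
  src i := ⟨_, ((Finite.equivFin {i // P (Γ.src i)}).symm i).2⟩
  tgt j := ⟨_, ((Finite.equivFin {j // P (Γ.tgt j)}).symm j).2⟩
  leg := Empty.elim
  two_ends x := by
    -- `f` includes the ends of the part into the ends of `Γ`; over an edge satisfying `P` it is a
    -- bijection of fibres.
    let f : Fin (Nat.card {i // P (Γ.src i)}) ⊕ Fin (Nat.card {j // P (Γ.tgt j)}) ⊕ Empty →
        Fin p ⊕ Fin q ⊕ Γ.H :=
      Sum.map (fun i => ((Finite.equivFin {i // P (Γ.src i)}).symm i).1)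
        (Sum.map (fun i => ((Finite.equivFin {j // P (Γ.tgt j)}).symm i).1) Empty.elim)
    have hf : Function.Injective f :=
      Function.Injective.sumMap (Subtype.val_injective.comp (Equiv.injective _))
        (Function.Injective.sumMap (Subtype.val_injective.comp (Equiv.injective _))
          (fun h => h.elim))
    suffices h : Nat.card {y // Sum.elim Γ.src (Sum.elim Γ.tgt Γ.leg) y = x.1} =
        Nat.card {y // Sum.elim (fun i => (⟨_, ((Finite.equivFin {i // P (Γ.src i)}).symm i).2⟩ :
          {e // P e})) (Sum.elim (fun j => ⟨_, ((Finite.equivFin {j // P (Γ.tgt j)}).symm j).2⟩)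
            Empty.elim) y = x} by
      rw [← h]
      exact Γ.two_ends x.1
    refine (Nat.card_congr ?_).symm
    refine Equiv.ofBijective (fun y => ⟨f y.1, ?_⟩) ⟨?_, ?_⟩
    · obtain ⟨(i | i | h), hy⟩ := y
      · exact congrArg Subtype.val hy
      · exact congrArg Subtype.val hy
      · exact h.elim
    · intro a b h
      exact Subtype.ext (hf (congrArg Subtype.val h))
    · rintro ⟨(i | i | h), hy⟩
      · have hi : P (Γ.src i) := by
          have := x.2
          rw [← hy] at this
          exact this
        refine ⟨⟨Sum.inl (Finite.equivFin {i // P (Γ.src i)} ⟨i, hi⟩), Subtype.ext ?_⟩,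
          Subtype.ext ?_⟩
        · simpa using hy
        · simp [f]
      · have hi : P (Γ.tgt i) := by
          have := x.2
          rw [← hy] at this
          exact this
        refine ⟨⟨Sum.inr (Sum.inl (Finite.equivFin {i // P (Γ.tgt i)} ⟨i, hi⟩)),
          Subtype.ext ?_⟩, Subtype.ext ?_⟩
        · simpa using hy
        · simp [f]
      · exact (IsEmpty.false h).elim
  valence v := v.elim

open Classical in
/-- The renumbering of end points that splits them according to a property. -/
noncomputable def splitEquiv (P : Fin p → Prop) :
    Fin p ≃ Fin (Nat.card {i // P i} + Nat.card {i // ¬ P i}) :=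
  ((Equiv.sumCompl P).symm.trans ((Finite.equivFin _).sumCongr (Finite.equivFin _))).trans
    finSumFinEquiv

/-- Without vertices nothing ties different edges together, so a graph is the juxtaposition of any
set of its edges with the complement, except that the end points of the two parts may be
interleaved. The strands on either side restore their numbering. -/
theorem restrictEdges_tensor (Γ : TypedGraph r₀ p q) [IsEmpty Γ.V] [IsEmpty Γ.H]
    (P : Γ.E → Prop) :
    comp (comp (strands r₀ (splitEquiv (fun j => P (Γ.tgt j))).symm)
        (tensor (restrictEdges Γ P) (restrictEdges Γ (fun e => ¬ P e))))
      (strands r₀ (splitEquiv (fun i => P (Γ.src i)))) ≈ Γ := by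
  classical
  let T := tensor (restrictEdges Γ P) (restrictEdges Γ (fun e => ¬ P e))
  -- An intermediate graph, with only the outgoing end points renumbered, so that the two sides can
  -- be treated in turn.
  let Δ : TypedGraph r₀ _ q :=
    { T with
      tgt := fun j => T.tgt (splitEquiv (fun j => P (Γ.tgt j)) j)
      two_ends := fun x => by
        rw [card_fibre_congr (g := Sum.elim T.src (Sum.elim T.tgt T.leg)) (d := x)
          ((Equiv.refl _).sumCongr ((splitEquiv (fun j => P (Γ.tgt j))).sumCongr (Equiv.refl _)))]
        · exact T.two_ends x
        · rintro (i | j | h) <;> rfl }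
  have h1 : comp (strands r₀ (splitEquiv (fun j => P (Γ.tgt j))).symm) T ≈ Δ :=
    comp_strands_left _ (Equiv.refl _) (Equiv.refl _) (Equiv.refl _) (fun _ => rfl)
      (fun _ => rfl) (fun _ => rfl) (fun j => congrArg T.tgt (Equiv.apply_symm_apply _ j))
  refine Setoid.trans (comp_congr h1 (Setoid.refl _)) ?_
  refine comp_strands_right _ (Equiv.equivOfIsEmpty (Empty ⊕ Empty) _)
    (Equiv.equivOfIsEmpty (Empty ⊕ Empty) _) (Equiv.sumCompl P) (fun h => ?_) (fun h => ?_) ?_ ?_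
  · exact isEmptyElim (α := Empty ⊕ Empty) h
  · exact isEmptyElim (α := Empty ⊕ Empty) h
  · intro i
    obtain ⟨i | i, rfl⟩ := (Equiv.sumCompl (fun i => P (Γ.src i))).surjective i <;>
      simp [Δ, T, tensor, restrictEdges, splitEquiv] <;> rfl
  · intro i
    obtain ⟨i | i, rfl⟩ := (Equiv.sumCompl (fun i => P (Γ.tgt i))).surjective i <;>
      simp [Δ, T, tensor, restrictEdges, splitEquiv] <;> rfl

theorem equiv_of_isEmpty {Γ Δ : TypedGraph r₀ p q} [IsEmpty Γ.V] [IsEmpty Γ.H] [IsEmpty Δ.V]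
    [IsEmpty Δ.H] (e : Γ.E ≃ Δ.E) (hs : ∀ i, Δ.src i = e (Γ.src i))
    (ht : ∀ i, Δ.tgt i = e (Γ.tgt i)) : Γ ≈ Δ :=
  ⟨⟨Equiv.equivOfIsEmpty _ _, Equiv.equivOfIsEmpty _ _, e, isEmptyElim, isEmptyElim, hs, ht⟩⟩

/-- A property of graphs that is invariant under isomorphisms, compositions and tensor products
holds for all graphs if it does for strands, the two arcs and the corollas. -/
theorem generated (G : ∀ p q : ℕ, TypedGraph r₀ p q → Prop)
    (iso : ∀ {p q} {Γ Γ' : TypedGraph r₀ p q}, Γ ≈ Γ' → G p q Γ → G p q Γ')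
    (hcomp : ∀ {p q r} {Φ : TypedGraph r₀ q r} {Γ : TypedGraph r₀ p q}, G q r Φ → G p q Γ →
      G p r (comp Φ Γ))
    (htensor : ∀ {p q p' q'} {Γ : TypedGraph r₀ p q} {Φ : TypedGraph r₀ p' q'}, G p q Γ →
      G p' q' Φ → G (p + p') (q + q') (tensor Γ Φ))
    (hstrands : ∀ {m n} (e : Fin m ≃ Fin n), G m n (strands r₀ e))
    (hcap : G 2 0 (cap r₀)) (hcup : G 0 2 (cup r₀))
    (hcorolla : ∀ r (hr : r₀ ≤ r), G r 0 (corolla r₀ r hr)) {p q : ℕ} (Γ : TypedGraph r₀ p q) :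
    G p q Γ := by
  have hone : ∀ {p q : ℕ} (Γ : TypedGraph r₀ p q) [IsEmpty Γ.V] [IsEmpty Γ.H] [Unique Γ.E],
      G p q Γ := by
    intro p q Γ _ _ _
    -- All end points lie on the only edge, leaving four cases: circle, `cap`, strand, `cup`.
    have h : p + q = 0 ∨ p + q = 2 := by
      have e : {x // Sum.elim Γ.src (Sum.elim Γ.tgt Γ.leg) x = default} ≃
          Fin p ⊕ Fin q ⊕ Γ.H := Equiv.subtypeUnivEquiv fun _ => Subsingleton.elim _ _
      have := Γ.two_ends default
      rw [Nat.card_congr e] at this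
      simpa using this
    have hpq : (p = 0 ∧ q = 0) ∨ (p = 2 ∧ q = 0) ∨ (p = 1 ∧ q = 1) ∨ (p = 0 ∧ q = 2) := by omega
    have hU : Unique (circle r₀).E := inferInstanceAs (Unique Unit)
    have hU1 : Unique (cap r₀).E := inferInstanceAs (Unique Unit)
    have hU2 : Unique (cup r₀).E := inferInstanceAs (Unique Unit)
    have hU3 : Unique (strands r₀ (Equiv.refl (Fin 1))).E := inferInstanceAs (Unique (Fin 1))
    have hV : IsEmpty (circle r₀).V := inferInstanceAs (IsEmpty Empty)
    have hV1 : IsEmpty (cap r₀).V := inferInstanceAs (IsEmpty Empty)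
    have hV2 : IsEmpty (cup r₀).V := inferInstanceAs (IsEmpty Empty)
    have hV3 : IsEmpty (strands r₀ (Equiv.refl (Fin 1))).V := inferInstanceAs (IsEmpty Empty)
    have hH : IsEmpty (circle r₀).H := inferInstanceAs (IsEmpty Empty)
    have hH1 : IsEmpty (cap r₀).H := inferInstanceAs (IsEmpty Empty)
    have hH2 : IsEmpty (cup r₀).H := inferInstanceAs (IsEmpty Empty)
    have hH3 : IsEmpty (strands r₀ (Equiv.refl (Fin 1))).H := inferInstanceAs (IsEmpty Empty)
    rcases hpq with ⟨rfl, rfl⟩ | ⟨rfl, rfl⟩ | ⟨rfl, rfl⟩ | ⟨rfl, rfl⟩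
    · exact iso (Setoid.trans cap_comp_cup (equiv_of_isEmpty (Equiv.ofUnique _ _)
        (fun _ => Subsingleton.elim _ _) fun _ => Subsingleton.elim _ _)) (hcomp hcap hcup)
    · exact iso (equiv_of_isEmpty (Equiv.ofUnique _ _)
        (fun _ => Subsingleton.elim _ _) fun _ => Subsingleton.elim _ _) hcap
    · exact iso (equiv_of_isEmpty (Equiv.ofUnique _ _)
        (fun _ => Subsingleton.elim _ _) fun _ => Subsingleton.elim _ _)
          (hstrands (Equiv.refl (Fin 1)))
    · exact iso (equiv_of_isEmpty (Equiv.ofUnique _ _)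
        (fun _ => Subsingleton.elim _ _) fun _ => Subsingleton.elim _ _) hcup
  -- Induction on the number of edges, one edge being split off at a time.
  have hedges : ∀ (n : ℕ) {p q : ℕ} (Γ : TypedGraph r₀ p q) [IsEmpty Γ.V] [IsEmpty Γ.H],
      Nat.card Γ.E = n → G p q Γ := by
    intro n
    induction n with
    | zero =>
      intro p q Γ _ _ hn
      have hE : IsEmpty Γ.E := (Finite.card_eq_zero_iff).1 hn
      obtain rfl : p = 0 := by
        by_contra h
        exact hE.elim (Γ.src ⟨0, Nat.pos_of_ne_zero h⟩)
      obtain rfl : q = 0 := by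
        by_contra h
        exact hE.elim (Γ.tgt ⟨0, Nat.pos_of_ne_zero h⟩)
      have hV : IsEmpty (strands r₀ (Equiv.refl (Fin 0))).V := inferInstanceAs (IsEmpty Empty)
      have hH : IsEmpty (strands r₀ (Equiv.refl (Fin 0))).H := inferInstanceAs (IsEmpty Empty)
      have hE' : IsEmpty (strands r₀ (Equiv.refl (Fin 0))).E := inferInstanceAs (IsEmpty (Fin 0))
      exact iso (equiv_of_isEmpty (Equiv.equivOfIsEmpty _ _) (fun i => i.elim0) fun i => i.elim0)
        (hstrands (Equiv.refl (Fin 0)))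
    | succ n ih =>
      intro p q Γ _ _ hn
      have : Nonempty Γ.E := (Finite.card_pos_iff).1 (by omega)
      obtain ⟨e⟩ := this
      refine iso (restrictEdges_tensor Γ (fun x => x = e))
        (hcomp (hcomp (hstrands _) (htensor ?_ ?_)) (hstrands _))
      · have h1 : IsEmpty (restrictEdges Γ (fun x => x = e)).V := inferInstanceAs (IsEmpty Empty)
        have h2 : IsEmpty (restrictEdges Γ (fun x => x = e)).H := inferInstanceAs (IsEmpty Empty)
        have h3 : Unique (restrictEdges Γ (fun x => x = e)).E :=
          inferInstanceAs (Unique {x // x = e})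
        exact hone _
      · have h1 : IsEmpty (restrictEdges Γ (fun x => ¬ x = e)).V := inferInstanceAs (IsEmpty Empty)
        have h2 : IsEmpty (restrictEdges Γ (fun x => ¬ x = e)).H := inferInstanceAs (IsEmpty Empty)
        refine ih _ ?_
        have := Nat.card_congr (by classical exact Equiv.sumCompl (fun x : Γ.E => x = e))
        rw [Nat.card_sum, hn, Nat.card_unique] at this
        change Nat.card {x // ¬ x = e} = n
        omega
  have hverts : ∀ (n : ℕ) {p q : ℕ} (Γ : TypedGraph r₀ p q), Nat.card Γ.V = n → G p q Γ := by
    intro n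
    induction n with
    | zero =>
      intro p q Γ hn
      have hV : IsEmpty Γ.V := (Finite.card_eq_zero_iff).1 hn
      have hH : IsEmpty Γ.H := ⟨fun h => hV.elim (Γ.vert h)⟩
      exact hedges _ Γ rfl
    | succ n ih =>
      intro p q Γ hn
      have : Nonempty Γ.V := (Finite.card_pos_iff).1 (by omega)
      obtain ⟨v⟩ := this
      -- The valence bound on `Γ` is what makes the corolla split off here an admissible generator.
      refine iso (removeVertex_comp Γ v (Γ.valence v) (Finite.equivFin _).symm)
        (hcomp (htensor (hstrands _) (hcorolla _ _)) (ih _ ?_))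
      have := Nat.card_congr (by classical exact Equiv.sumCompl (fun x : Γ.V => x = v))
      rw [Nat.card_sum, hn, Nat.card_unique] at this
      change Nat.card {x // ¬ x = v} = n
      omega
  exact hverts _ Γ rfl

end TypedGraph

/-! ### Strand graphs from adjacent transpositions -/

/-- The sum of two bijections, on the concatenation of the index sets. -/
def finSumCongr {m n m' n' : ℕ} (e : Fin m ≃ Fin n) (e' : Fin m' ≃ Fin n') :
    Fin (m + m') ≃ Fin (n + n') :=
  finSumFinEquiv.symm.trans ((e.sumCongr e').trans finSumFinEquiv)

/-- A transposition of neighbours is a crossing of two strands with `a` parallel strands before it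
and `b` after it. The casts account for `n + 1` and `a + (1 + 1) + b` being only propositionally
equal. -/
theorem swap_eq_finSumCongr {n : ℕ} (i : Fin n) {a b : ℕ} (ha : i = a)
    (h : n + 1 = a + (1 + 1) + b) :
    Equiv.swap i.castSucc i.succ = (finCongr h).trans
      ((finSumCongr (finSumCongr (Equiv.refl (Fin a))
      (finAddFlip (m := 1) (n := 1))) (Equiv.refl (Fin b))).trans (finCongr h.symm)) := by
  ext x
  obtain ⟨y, rfl⟩ := (finCongr h).symm.surjective x
  obtain ⟨y | y, rfl⟩ := finSumFinEquiv.surjective y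
  · obtain ⟨y | y, rfl⟩ := finSumFinEquiv.surjective y
    · rw [Equiv.swap_apply_of_ne_of_ne]
      · simp [finSumCongr]
      · intro h'
        have := congrArg Fin.val h'
        simp at this
        omega
      · intro h'
        have := congrArg Fin.val h'
        simp at this
        omega
    · obtain ⟨y | y, rfl⟩ :=
        (finSumFinEquiv : Fin 1 ⊕ Fin 1 ≃ Fin (1 + 1)).surjective y <;>
        obtain rfl : y = 0 := Subsingleton.elim _ _
      · have h1 : (finCongr h).symm (finSumFinEquiv (Sum.inl (finSumFinEquiv (Sum.inr
          (finSumFinEquiv (Sum.inl 0)))))) = i.castSucc := Fin.ext (by simp [ha]; rfl)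
        rw [congrArg (Equiv.swap _ _) h1, Equiv.swap_apply_left]
        simp [finSumCongr, ha]
        rfl
      · have h1 : (finCongr h).symm (finSumFinEquiv (Sum.inl (finSumFinEquiv (Sum.inr
          (finSumFinEquiv (Sum.inr 0)))))) = i.succ := Fin.ext (by simp [ha]; rfl)
        rw [congrArg (Equiv.swap _ _) h1, Equiv.swap_apply_right]
        simp [finSumCongr, ha]
        rfl
  · rw [Equiv.swap_apply_of_ne_of_ne]
    · simp [finSumCongr]
    · intro h'
      have := congrArg Fin.val h'
      simp at this
      omega
    · intro h'
      have := congrArg Fin.val h'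
      simp at this
      omega

/-- A property of bijections between initial segments that is stable under composition and sums
holds for all of them if it does for identities and for the transposition of two elements. -/
theorem finEquiv_induction (G : ∀ m n : ℕ, Fin m ≃ Fin n → Prop)
    (refl : ∀ n, G n n (Equiv.refl _))
    (flip : G (1 + 1) (1 + 1) (finAddFlip (m := 1) (n := 1)))
    (trans : ∀ {m n l} {e : Fin m ≃ Fin n} {e' : Fin n ≃ Fin l}, G _ _ e → G _ _ e' →
      G _ _ (e.trans e'))
    (sum : ∀ {m n m' n'} {e : Fin m ≃ Fin n} {e' : Fin m' ≃ Fin n'}, G _ _ e → G _ _ e' →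
      G _ _ (finSumCongr e e')) {m n : ℕ} (e : Fin m ≃ Fin n) : G m n e := by
  have hcast : ∀ {m n : ℕ} (h : m = n), G m n (finCongr h) := by
    rintro m n rfl
    exact refl m
  obtain rfl : m = n := by simpa using Fintype.card_congr e
  cases m with
  | zero =>
    rw [Subsingleton.elim e (Equiv.refl _)]
    exact refl 0
  | succ n =>
    -- Adjacent transpositions generate the symmetric group already as a monoid, so `G` need not be
    -- stable under inverses.
    have h : e ∈ Submonoid.closure (Set.range fun i : Fin n => Equiv.swap i.castSucc i.succ) := by
      rw [Equiv.Perm.mclosure_swap_castSucc_succ]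
      trivial
    induction h using Submonoid.closure_induction with
    | mem x hx =>
      obtain ⟨i, rfl⟩ := hx
      have h : n + 1 = i.1 + (1 + 1) + (n - 1 - i.1) := by omega
      dsimp only
      rw [swap_eq_finSumCongr i rfl h]
      exact trans (hcast _) (trans (sum (sum (refl _) flip) (refl _)) (hcast _))
    | one => exact refl _
    -- A product of permutations applies its right factor first, hence the reversed order.
    | mul x y _ _ hx hy => exact trans hy hx

theorem sum_fin_cons {I k : Type*} [Fintype I] [AddCommMonoid k] {n : ℕ}
    (F : (Fin (n + 1) → I) → k) : ∑ c, F c = ∑ a, ∑ c, F (Fin.cons a c) := by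
  rw [← Fintype.sum_prod_type' (fun a c => F (Fin.cons a c))]
  exact (Fintype.sum_equiv (Fin.consEquiv fun _ => I) _ _ fun _ => rfl).symm

theorem sum_fin_zero {I k : Type*} [Fintype I] [AddCommMonoid k]
    (F : (Fin 0 → I) → k) : ∑ c, F c = F ![] := by
  rw [Fintype.sum_unique]
  exact congrArg F (Subsingleton.elim _ _)

namespace TypedGraph

theorem tensor_strands {r₀ m n m' n' : ℕ} (e : Fin m ≃ Fin n) (e' : Fin m' ≃ Fin n') :
    tensor (strands r₀ e) (strands r₀ e') ≈ strands r₀ (finSumCongr e e') := by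
  refine ⟨⟨Equiv.equivOfIsEmpty (Empty ⊕ Empty) Empty, Equiv.equivOfIsEmpty (Empty ⊕ Empty) Empty,
    finSumFinEquiv, fun h => isEmptyElim (α := Empty ⊕ Empty) h,
    fun h => isEmptyElim (α := Empty ⊕ Empty) h, fun i => ?_, fun j => ?_⟩⟩
  · obtain ⟨i | i, rfl⟩ := finSumFinEquiv.surjective i <;> simp [tensor, strands] <;> rfl
  · obtain ⟨i | i, rfl⟩ := finSumFinEquiv.surjective j <;>
      simp [tensor, strands, finSumCongr] <;> rfl

end TypedGraph

/-! ### Matrix representations: consequences of the relations, and uniqueness -/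

/-- A representation of the PROP of graphs by matrices, the rows and columns of which are indexed
by colourings of the outgoing and the ingoing end points. -/
structure IsMatrixProp {k I : Type*} [Field k] [Fintype I] [DecidableEq I] {r₀ : ℕ}
    (M : ∀ p q : ℕ, TypedGraph r₀ p q → Matrix (Fin q → I) (Fin p → I) k) : Prop where
  iso : ∀ {p q} {Γ Γ' : TypedGraph r₀ p q}, Γ ≈ Γ' → M p q Γ = M p q Γ'
  comp : ∀ {p q r} (Φ : TypedGraph r₀ q r) (Γ : TypedGraph r₀ p q),
    M p r (Φ.comp Γ) = M q r Φ * M p q Γ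
  tensor : ∀ {p q p' q'} (Γ : TypedGraph r₀ p q) (Φ : TypedGraph r₀ p' q') c' c,
    M (p + p') (q + q') (Γ.tensor Φ) c' c =
      M p q Γ (c' ∘ Fin.castAdd q') (c ∘ Fin.castAdd p') *
        M p' q' Φ (c' ∘ Fin.natAdd q) (c ∘ Fin.natAdd p)
  id : ∀ n, M n n (TypedGraph.id r₀ n) = 1
  braiding : ∀ m n c' c, M (m + n) (n + m) (TypedGraph.braiding r₀ m n) c' c =
    if c = c' ∘ finAddFlip then 1 else 0

namespace IsMatrixProp

variable {k I : Type*} [Field k] [Fintype I] [DecidableEq I] {r₀ : ℕ}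
  {M M' : ∀ p q : ℕ, TypedGraph r₀ p q → Matrix (Fin q → I) (Fin p → I) k}

/-- The axioms prescribe the values on identities and block crossings only. The crossing of two
single strands together with identities generates all strand graphs under composition and
juxtaposition, and permutation matrices are compatible with both. -/
theorem strands_apply (hM : IsMatrixProp M) {m n : ℕ} (e : Fin m ≃ Fin n) (c' : Fin n → I)
    (c : Fin m → I) : M m n (TypedGraph.strands r₀ e) c' c = if c = c' ∘ e then 1 else 0 := by
  refine finEquiv_induction (fun m n e => ∀ (c' : Fin n → I) (c : Fin m → I),
    M m n (TypedGraph.strands r₀ e) c' c = if c = c' ∘ e then 1 else 0) ?_ ?_ ?_ ?_ e c' c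
  · intro n c' c
    rw [← TypedGraph.id, hM.id, Matrix.one_apply]
    simp [eq_comm]
  · exact hM.braiding 1 1
  · intro m n l e e' h h' c' c
    rw [← hM.iso (TypedGraph.strands_comp e e'), hM.comp, Matrix.mul_apply]
    simp only [h, h']
    rw [Finset.sum_eq_single (c' ∘ e')]
    · rw [if_pos rfl, one_mul]
      exact if_congr Iff.rfl rfl rfl
    · intro b _ hb
      simp [hb]
    · simp
  · intro m n m' n' e e' h h' c' c
    rw [← hM.iso (TypedGraph.tensor_strands e e'), hM.tensor, h, h', ite_zero_mul_ite_zero, mul_one]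
    refine if_congr ⟨?_, ?_⟩ rfl rfl
    · rintro ⟨h1, h2⟩
      funext i
      obtain ⟨i | i, rfl⟩ := finSumFinEquiv.surjective i
      · simpa [finSumCongr] using congrFun h1 i
      · simpa [finSumCongr] using congrFun h2 i
    · rintro rfl
      constructor
      · funext i
        simp [finSumCongr, ← finSumFinEquiv_apply_left]
      · funext i
        simp [finSumCongr, ← finSumFinEquiv_apply_right]

theorem cap_symm (hM : IsMatrixProp M) (i j : I) :
    M 2 0 (TypedGraph.cap r₀) ![] ![i, j] = M 2 0 (TypedGraph.cap r₀) ![] ![j, i] := by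
  conv_lhs => rw [← hM.iso TypedGraph.cap_comp_swap, hM.comp, Matrix.mul_apply]
  rw [Finset.sum_eq_single ![j, i]]
  · rw [hM.strands_apply, if_pos, mul_one]
    funext x
    fin_cases x <;> rfl
  · intro b _ hb
    rw [hM.strands_apply, if_neg, mul_zero]
    intro h
    apply hb
    funext x
    fin_cases x
    · exact (congrFun h 1).symm
    · exact (congrFun h 0).symm
  · simp

theorem corolla_symm (hM : IsMatrixProp M) {r : ℕ} (hr : r₀ ≤ r) (σ : Equiv.Perm (Fin r))
    (c : Fin r → I) : M r 0 (TypedGraph.corolla r₀ r hr) ![] (c ∘ σ) =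
      M r 0 (TypedGraph.corolla r₀ r hr) ![] c := by
  conv_lhs => rw [← hM.iso (TypedGraph.corolla_comp_strands hr σ), hM.comp, Matrix.mul_apply]
  rw [Finset.sum_eq_single c]
  · rw [hM.strands_apply, if_pos rfl, mul_one]
  · intro b _ hb
    rw [hM.strands_apply, if_neg, mul_zero]
    exact fun h => hb (σ.surjective.injective_comp_right h).symm
  · simp

/-- This is the snake identity read entrywise: the two straight strands force the outer colours to
be `i` and `j`, and the sum left over the colour between the arcs is a matrix product. -/
theorem cap_mul_cup (hM : IsMatrixProp M) :
    (Matrix.of fun i j => M 2 0 (TypedGraph.cap r₀) ![] ![i, j]) *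
      (Matrix.of fun i j => M 0 2 (TypedGraph.cup r₀) ![i, j] ![]) = 1 := by
  ext i j
  have h := congrFun (congrFun (hM.iso (TypedGraph.snake (r₀ := r₀))) ![j]) ![i]
  rw [hM.id, hM.comp, Matrix.mul_apply, sum_fin_cons] at h
  simp only [sum_fin_cons, sum_fin_zero] at h
  have h0 : ∀ a b d : I, M 3 1 (TypedGraph.tensor (p := 2) (p' := 1) (q := 0) (q' := 1)
      (TypedGraph.cap r₀) (TypedGraph.id r₀ 1)) ![j] ![a, b, d] =
        M 2 0 (TypedGraph.cap r₀) ![] ![a, b] * if j = d then 1 else 0 := by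
    intro a b d
    refine (hM.tensor (TypedGraph.cap r₀) (TypedGraph.id r₀ 1) ![j] ![a, b, d]).trans ?_
    rw [hM.id, Matrix.one_apply]
    congr 1
    · congr 1
      · exact Subsingleton.elim _ _
      · funext x
        fin_cases x <;> rfl
    · refine if_congr ⟨fun h => congrFun h 0, fun h => ?_⟩ rfl rfl
      funext x
      fin_cases x
      exact h
  have h1 : ∀ a b d : I, M 1 3 (TypedGraph.tensor (p := 1) (p' := 0) (q := 1) (q' := 2)
      (TypedGraph.id r₀ 1) (TypedGraph.cup r₀)) ![a, b, d] ![i] =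
        (if a = i then 1 else 0) * M 0 2 (TypedGraph.cup r₀) ![b, d] ![] := by
    intro a b d
    refine (hM.tensor (TypedGraph.id r₀ 1) (TypedGraph.cup r₀) ![a, b, d] ![i]).trans ?_
    rw [hM.id, Matrix.one_apply]
    congr 1
    · refine if_congr ⟨fun h => congrFun h 0, fun h => ?_⟩ rfl rfl
      funext x
      fin_cases x
      exact h
    · congr 1
      · funext x
        fin_cases x <;> rfl
      · exact Subsingleton.elim _ _
  have h2 : ∀ a b d : I, (Fin.cons a (Fin.cons b (Fin.cons d ![] : Fin 1 → I) : Fin 2 → I) :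
      Fin 3 → I) = ![a, b, d] := fun _ _ _ => rfl
  have h3 : (1 : Matrix (Fin 1 → I) (Fin 1 → I) k) ![j] ![i] = (1 : Matrix I I k) i j := by
    rw [Matrix.one_apply, Matrix.one_apply]
    exact if_congr ⟨fun h => (congrFun h 0).symm, fun h => by rw [h]⟩ rfl rfl
  simp only [h2, h0, h1] at h
  rw [h3] at h
  rw [← h, Matrix.mul_apply]
  simp

theorem cup_mul_cap (hM : IsMatrixProp M) :
    (Matrix.of fun i j => M 0 2 (TypedGraph.cup r₀) ![i, j] ![]) *
      (Matrix.of fun i j => M 2 0 (TypedGraph.cap r₀) ![] ![i, j]) = 1 :=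
  mul_eq_one_comm.1 hM.cap_mul_cup

/-- A representation of the PROP of graphs is determined by its values on the arc and on the
corollas. -/
theorem ext (hM : IsMatrixProp M) (hM' : IsMatrixProp M')
    (hcap : M 2 0 (TypedGraph.cap r₀) = M' 2 0 (TypedGraph.cap r₀))
    (hcorolla : ∀ r (hr : r₀ ≤ r),
      M r 0 (TypedGraph.corolla r₀ r hr) = M' r 0 (TypedGraph.corolla r₀ r hr))
    {p q : ℕ} (Γ : TypedGraph r₀ p q) : M p q Γ = M' p q Γ := by
  refine TypedGraph.generated (fun p q Γ => M p q Γ = M' p q Γ) ?_ ?_ ?_ ?_ hcap ?_ hcorolla Γ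
  · intro p q Γ Γ' h h'
    rw [← hM.iso h, h', hM'.iso h]
  · intro p q r Φ Γ h h'
    rw [hM.comp, h, h', hM'.comp]
  · intro p q p' q' Γ Φ h h'
    ext c' c
    rw [hM.tensor, h, h', hM'.tensor]
  · intro m n e
    ext c' c
    rw [hM.strands_apply, hM'.strands_apply]
  -- The value on `cup` is no independent datum: in both representations it is the inverse of the
  -- same matrix, that of `cap`.
  · have h1 := hM.cup_mul_cap
    rw [hcap] at h1
    have h2 := left_inv_eq_right_inv h1 hM'.cap_mul_cup
    ext c' c
    have h3 := congrFun (congrFun h2 (c' 0)) (c' 1)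
    obtain rfl : c = ![] := Subsingleton.elim _ _
    rwa [Matrix.of_apply, Matrix.of_apply, show ![c' 0, c' 1] = c' by
      funext x; fin_cases x <;> rfl] at h3

end IsMatrixProp

/-! ### Edges as fibres with two or no ends -/

/-- The elements `a` and `b` are the two distinct elements of the fibre of `f` over `c`. -/
structure IsEndPair {X C : Type*} (f : X → C) (c : C) (a b : X) : Prop where
  ne : a ≠ b
  left : f a = c
  right : f b = c
  eq_or_eq : ∀ y, f y = c → y = a ∨ y = b

/-- Each of the fibres of `f` is empty or consists of two elements. -/
def TwoEnds {X C : Type*} (f : X → C) : Prop :=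
  ∀ c, (∀ y, f y ≠ c) ∨ ∃ a b, IsEndPair f c a b

theorem IsEndPair.symm {X C : Type*} {f : X → C} {c : C} {a b : X} (h : IsEndPair f c a b) :
    IsEndPair f c b a :=
  ⟨h.ne.symm, h.right, h.left, fun y hy => (h.eq_or_eq y hy).symm⟩

theorem TwoEnds.exists_isEndPair {X C : Type*} {f : X → C} (h : TwoEnds f) (a : X) :
    ∃ b, IsEndPair f (f a) a b := by
  rcases h (f a) with h | ⟨b, b', h⟩
  · exact (h a rfl).elim
  · rcases h.eq_or_eq a rfl with rfl | rfl
    · exact ⟨b', h⟩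
    · exact ⟨b, h.symm⟩

theorem TwoEnds.of_card {X C : Type*} [Finite X] {f : X → C}
    (h : ∀ c, Nat.card {x // f x = c} = 0 ∨ Nat.card {x // f x = c} = 2) : TwoEnds f := by
  intro c
  rcases h c with h | h
  · left
    intro y hy
    have := Finite.card_eq_zero_iff.1 h
    exact this.elim ⟨y, hy⟩
  · right
    obtain ⟨a, b, hab, hu⟩ := Nat.card_eq_two_iff.1 h
    refine ⟨a.1, b.1, fun h => hab (Subtype.ext h), a.2, b.2, fun y hy => ?_⟩
    have : (⟨y, hy⟩ : {x // f x = c}) ∈ ({a, b} : Set _) := by rw [hu]; trivial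
    rcases this with h | h
    · exact Or.inl (congrArg Subtype.val h)
    · exact Or.inr (congrArg Subtype.val h)

theorem TwoEnds.card {X C : Type*} [Finite X] {f : X → C} (h : TwoEnds f) (c : C) :
    Nat.card {x // f x = c} = 0 ∨ Nat.card {x // f x = c} = 2 := by
  rcases h c with h | ⟨a, b, h⟩
  · left
    rw [Finite.card_eq_zero_iff]
    exact ⟨fun y => h y.1 y.2⟩
  · right
    rw [Nat.card_eq_two_iff]
    refine ⟨⟨a, h.left⟩, ⟨b, h.right⟩, fun hab => h.ne (congrArg Subtype.val hab), ?_⟩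
    ext y
    simpa [Subtype.ext_iff] using h.eq_or_eq y.1 y.2

theorem TypedGraph.twoEnds {r₀ p q : ℕ} (Γ : TypedGraph r₀ p q) :
    TwoEnds (Sum.elim Γ.src (Sum.elim Γ.tgt Γ.leg)) :=
  TwoEnds.of_card Γ.two_ends

/-! ### Edge weights and their behaviour under gluing -/

section Weight

variable {k T I : Type*}

open Classical in
/-- The weight of an edge whose ends carry the states `x`. -/
noncomputable def edgeWeight (β : T → T → k) (z : k) {X C : Type*} (f : X → C) (x : X → T) (c : C) :
    k :=
  -- The chosen pair has an arbitrary order, harmless for symmetric `β`. The default `z` serves as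
  -- the weight of circles.
  if h : ∃ p : X × X, IsEndPair f c p.1 p.2 then β (x h.choose.1) (x h.choose.2) else z

variable {β : T → T → k} {z : k} {X Y C D : Type*}

theorem edgeWeight_of_pair (hβ : ∀ x y, β x y = β y x) {f : X → C} {x : X → T} {c : C} {a b : X}
    (h : IsEndPair f c a b) : edgeWeight β z f x c = β (x a) (x b) := by
  have hex : ∃ p : X × X, IsEndPair f c p.1 p.2 := ⟨(a, b), h⟩
  rw [edgeWeight, dif_pos hex]
  have h' := hex.choose_spec
  rcases h.eq_or_eq _ h'.left with h1 | h1 <;> rcases h.eq_or_eq _ h'.right with h2 | h2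
  · exact (h'.ne (h1.trans h2.symm)).elim
  · rw [h1, h2]
  · rw [h1, h2, hβ]
  · exact (h'.ne (h1.trans h2.symm)).elim

theorem edgeWeight_of_forall_ne {f : X → C} {x : X → T} {c : C} (h : ∀ y, f y ≠ c) :
    edgeWeight β z f x c = z := by
  rw [edgeWeight, dif_neg]
  rintro ⟨p, hp⟩
  exact h _ hp.left

/-- Only the fibre matters: `i` carries the fibre over `c` bijectively onto that over `d` and
respects the states, and no condition is imposed elsewhere. It therefore serves isomorphisms,
inclusions into disjoint unions and edges untouched by a gluing alike. -/
theorem edgeWeight_eq (hβ : ∀ x y, β x y = β y x) {f : X → C} {g : Y → D} {x : X → T} {y : Y → T}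
    {c : C} {d : D} (hf : (∀ y, f y ≠ c) ∨ ∃ a b, IsEndPair f c a b) (i : X → Y)
    (hi : Function.Injective i) (hx : ∀ a, f a = c → y (i a) = x a)
    (hc : ∀ a, f a = c → g (i a) = d) (hd : ∀ b, g b = d → ∃ a, f a = c ∧ i a = b) :
    edgeWeight β z f x c = edgeWeight β z g y d := by
  rcases hf with hf | ⟨a, b, h⟩
  · rw [edgeWeight_of_forall_ne hf, edgeWeight_of_forall_ne]
    intro b hb
    obtain ⟨a, ha, -⟩ := hd b hb
    exact hf a ha
  · rw [edgeWeight_of_pair hβ h, edgeWeight_of_pair hβ (a := i a) (b := i b), hx _ h.left,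
      hx _ h.right]
    refine ⟨fun hab => h.ne (hi hab), hc _ h.left, hc _ h.right, fun y hy => ?_⟩
    obtain ⟨a', ha', rfl⟩ := hd y hy
    exact (h.eq_or_eq a' ha').imp (congrArg i) (congrArg i)

variable [CommSemiring k]

/-- The product of the weights of the edges. -/
noncomputable def edgesWeight (β : T → T → k) (z : k) {X C : Type*} (f : X → C) (x : X → T) : k :=
  ∏ᶠ c, edgeWeight β z f x c

theorem edgesWeight_congr (hβ : ∀ x y, β x y = β y x) {f : X → C} {g : Y → D} {x : X → T}
    {y : Y → T} (hf : TwoEnds f) (eX : X ≃ Y) (eC : C ≃ D) (hfg : ∀ a, g (eX a) = eC (f a))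
    (hxy : ∀ a, y (eX a) = x a) : edgesWeight β z f x = edgesWeight β z g y := by
  rw [edgesWeight, edgesWeight, ← finprod_comp_equiv eC]
  refine finprod_congr fun c => edgeWeight_eq hβ (hf c) eX eX.injective (fun a _ => hxy a)
    (fun a ha => by rw [hfg, ha]) fun b hb => ?_
  obtain ⟨a, rfl⟩ := eX.surjective b
  rw [hfg] at hb
  exact ⟨a, eC.injective hb, rfl⟩

theorem edgesWeight_sum [Finite C] [Finite D] (hβ : ∀ x y, β x y = β y x) {f : X → C} {g : Y → D}
    {x : X → T} {y : Y → T} (hf : TwoEnds f) (hg : TwoEnds g) :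
    edgesWeight β z (Sum.map f g) (Sum.elim x y) = edgesWeight β z f x * edgesWeight β z g y := by
  have := Fintype.ofFinite C
  have := Fintype.ofFinite D
  simp only [edgesWeight, finprod_eq_prod_of_fintype, Fintype.prod_sum_type]
  congr 1
  · refine Finset.prod_congr rfl fun c _ => (edgeWeight_eq hβ (hf c) Sum.inl Sum.inl_injective
      (fun _ _ => rfl) (fun a ha => by rw [Sum.map_inl, ha]) ?_).symm
    rintro (b | b) hb
    · exact ⟨b, Sum.inl_injective hb, rfl⟩
    · exact (Sum.inr_ne_inl hb).elim
  · refine Finset.prod_congr rfl fun c _ => (edgeWeight_eq hβ (hg c) Sum.inr Sum.inr_injective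
      (fun _ _ => rfl) (fun a ha => by rw [Sum.map_inr, ha]) ?_).symm
    rintro (b | b) hb
    · exact (Sum.inl_ne_inr hb).elim
    · exact ⟨b, Sum.inr_injective hb, rfl⟩

/-- Contracting the states at two ends that are glued. -/
theorem sum_edgesWeight_glue_pair [Fintype I] [Finite C] [Finite D] (hβ : ∀ x y, β x y = β y x)
    {e d : I → T}
    (hcontr : ∀ x y, ∑ i, β x (d i) * β (e i) y = β x y) (hz : ∑ i, β (d i) (e i) = z)
    {f : X → C} {p q : C}
    (hf : TwoEnds (Sum.elim f (Sum.elim (fun _ : Unit => p) fun _ : Unit => q)))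
    {π : C → D} (hsurj : Function.Surjective π)
    (hπ : ∀ a b, π a = π b ↔ a = b ∨ (a = p ∧ b = q) ∨ (a = q ∧ b = p)) (x : X → T) :
    ∑ i, edgesWeight β z (Sum.elim f (Sum.elim (fun _ : Unit => p) fun _ : Unit => q))
      (Sum.elim x (Sum.elim (fun _ => d i) fun _ => e i)) = edgesWeight β z (π ∘ f) x := by
  classical
  have := Fintype.ofFinite C
  have := Fintype.ofFinite D
  set F := Sum.elim f (Sum.elim (fun _ : Unit => p) fun _ : Unit => q) with hF
  have hpq : π p = π q := (hπ _ _).2 (Or.inr (Or.inl ⟨rfl, rfl⟩))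
  -- An edge away from the gluing is the image of a single unglued edge with the same ends.
  have hother : ∀ K, K ≠ π p → ∀ y : Unit ⊕ Unit → T,
      ∏ c with π c = K, edgeWeight β z F (Sum.elim x y) c = edgeWeight β z (π ∘ f) x K := by
    intro K hK y
    obtain ⟨c, rfl⟩ := hsurj K
    have hc : ∀ a, π a = π c → a = c := by
      intro a ha
      rcases (hπ a c).1 ha with h | ⟨-, h⟩ | ⟨-, h⟩
      · exact h
      · exact (hK (by rw [h, hpq])).elim
      · exact (hK (by rw [h])).elim
    rw [Finset.prod_eq_single_of_mem c (by simp)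
      (fun b hb hbc => (hbc (hc b (Finset.mem_filter.1 hb).2)).elim)]
    have hfc : ∀ u, F u = c → ∃ a, f a = c ∧ Sum.inl a = u := by
      rintro (u | u | u) hu
      · exact ⟨u, hu, rfl⟩
      · exact (hK (congrArg π hu.symm)).elim
      · exact (hK ((congrArg π hu.symm).trans hpq.symm)).elim
    symm
    refine edgeWeight_eq hβ ?_ Sum.inl Sum.inl_injective (fun _ _ => rfl)
      (fun a ha => hc _ ha) (fun u hu => ?_)
    · rcases hf c with h | ⟨a, b, h⟩
      · exact Or.inl fun u hu => h (Sum.inl u) (hc _ hu)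
      · obtain ⟨a, -, rfl⟩ := hfc a h.left
        obtain ⟨b, -, rfl⟩ := hfc b h.right
        refine Or.inr ⟨a, b, fun hab => h.ne (congrArg _ hab), congrArg π h.left,
          congrArg π h.right, fun u hu => ?_⟩
        exact (h.eq_or_eq (Sum.inl u) (hc _ hu)).imp (fun h => Sum.inl_injective h)
          (fun h => Sum.inl_injective h)
    · obtain ⟨a, ha, rfl⟩ := hfc u hu
      exact ⟨a, congrArg π ha, rfl⟩
  have hmain : ∑ i, ∏ c with π c = π p,
      edgeWeight β z F (Sum.elim x (Sum.elim (fun _ => d i) fun _ => e i)) c =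
        edgeWeight β z (π ∘ f) x (π p) := by
    -- If `p = q`, the glued ends are both ends of one edge, which closes to a circle of weight `z`.
    -- Otherwise two edges merge into one, whose ends `u` and `v` are their remaining ends, and
    -- `hcontr` applies.
    by_cases h : p = q
    · subst h
      have hp : ∀ c, π c = π p ↔ c = p := fun c => by rw [hπ]; tauto
      have hfib : (Finset.univ.filter fun c => π c = π p) = {p} := by
        ext c
        simp [hp]
      have hpair : IsEndPair F p (Sum.inr (Sum.inl ())) (Sum.inr (Sum.inr ())) := by
        obtain ⟨b, hb⟩ := hf.exists_isEndPair (Sum.inr (Sum.inl ()))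
        rcases hb.eq_or_eq (Sum.inr (Sum.inr ())) rfl with h | rfl
        · simp at h
        · exact hb
      simp only [hfib, Finset.prod_singleton, edgeWeight_of_pair hβ hpair, Sum.elim_inr,
        Sum.elim_inl]
      rw [hz, edgeWeight_of_forall_ne]
      intro y hy
      have := hpair.eq_or_eq (Sum.inl y) ((hp _).1 hy)
      simp at this
    · have hfib : (Finset.univ.filter fun c => π c = π p) = {p, q} := by
        ext c
        simp only [Finset.mem_filter, Finset.mem_univ, true_and, hπ, Finset.mem_insert,
          Finset.mem_singleton]
        tauto
      have hp : ∃ u, IsEndPair F p (Sum.inl u) (Sum.inr (Sum.inl ())) := by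
        obtain ⟨u | u | u, hu⟩ := hf.exists_isEndPair (Sum.inr (Sum.inl ()))
        · exact ⟨u, hu.symm⟩
        · exact (hu.ne rfl).elim
        · exact (h hu.right.symm).elim
      have hq : ∃ u, IsEndPair F q (Sum.inr (Sum.inr ())) (Sum.inl u) := by
        obtain ⟨u | u | u, hu⟩ := hf.exists_isEndPair (Sum.inr (Sum.inr ()))
        · exact ⟨u, hu⟩
        · exact (h hu.right).elim
        · exact (hu.ne rfl).elim
      obtain ⟨u, hu⟩ := hp
      obtain ⟨v, hv⟩ := hq
      simp only [hfib, Finset.prod_pair h, edgeWeight_of_pair hβ hu, edgeWeight_of_pair hβ hv,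
        Sum.elim_inr, Sum.elim_inl]
      rw [hcontr, edgeWeight_of_pair hβ (a := u) (b := v)]
      refine ⟨?_, congrArg π hu.left, (congrArg π hv.right).trans hpq.symm, fun y hy => ?_⟩
      · rintro rfl
        exact h (hu.left.symm.trans hv.right)
      · rcases (hπ _ _).1 hy with h1 | ⟨-, h1⟩ | ⟨h1, -⟩
        · exact Or.inl (by simpa using hu.eq_or_eq (Sum.inl y) h1)
        · exact (h h1).elim
        · exact Or.inr (by simpa using hv.eq_or_eq (Sum.inl y) h1)
  simp only [edgesWeight, finprod_eq_prod_of_fintype]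
  -- The unglued edges are grouped by their image under `π`; only the group over `π p` has a weight
  -- depending on `i`.
  rw [← Finset.mul_prod_erase _ _ (Finset.mem_univ (π p)), ← hmain, Finset.sum_mul]
  refine Finset.sum_congr rfl fun i _ => ?_
  rw [← Finset.prod_fiberwise _ π, ← Finset.mul_prod_erase _ _ (Finset.mem_univ (π p))]
  congr 1
  exact Finset.prod_congr rfl fun K hK => hother K (Finset.ne_of_mem_erase hK) _

variable [Fintype I]

/-- Adding one gluing to an equivalence relation at most merges the two classes of `s 0` and `t 0`.
This is the form of `hπ` in `sum_edgesWeight_glue_pair`. -/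
theorem eqvGen_glue_succ_iff {C : Type} {n : ℕ} (s t : Fin (n + 1) → C) (a b : C) :
    Relation.EqvGen (Glue s t) a b ↔
      (Quot.mk (Glue (fun i : Fin n => s i.succ) fun i => t i.succ) a = Quot.mk _ b ∨
      (Quot.mk (Glue (fun i : Fin n => s i.succ) fun i => t i.succ) a = Quot.mk _ (s 0) ∧
        Quot.mk (Glue (fun i : Fin n => s i.succ) fun i => t i.succ) b = Quot.mk _ (t 0)) ∨
      (Quot.mk (Glue (fun i : Fin n => s i.succ) fun i => t i.succ) a = Quot.mk _ (t 0) ∧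
        Quot.mk (Glue (fun i : Fin n => s i.succ) fun i => t i.succ) b = Quot.mk _ (s 0))) := by
  have h0 : Relation.EqvGen (Glue s t) (s 0) (t 0) := .rel _ _ (Glue.mk 0)
  have hmk : ∀ {a b}, Quot.mk (Glue (fun i : Fin n => s i.succ) fun i => t i.succ) a =
      Quot.mk _ b → Relation.EqvGen (Glue s t) a b := by
    intro a b h
    have h' := Quot.eqvGen_exact h
    clear h
    induction h' with
    | rel x y h =>
      obtain ⟨i⟩ := h
      exact .rel _ _ (Glue.mk i.succ)
    | refl x => exact .refl x
    | symm x y _ ih => exact .symm _ _ ih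
    | trans x y z _ _ ih1 ih2 => exact .trans _ _ _ ih1 ih2
  constructor
  · intro h
    induction h with
    | rel x y h =>
      obtain ⟨i⟩ := h
      induction i using Fin.cases with
      | zero => exact Or.inr (Or.inl ⟨rfl, rfl⟩)
      | succ i => exact Or.inl (Quot.sound (Glue.mk i))
    | refl x => exact Or.inl rfl
    | symm x y _ ih => grind
    | trans x y z _ _ ih1 ih2 => grind
  · rintro (h | ⟨h, h'⟩ | ⟨h, h'⟩)
    · exact hmk h
    · exact (hmk h).trans _ _ _ (h0.trans _ _ _ (hmk h').symm)
    · exact (hmk h).trans _ _ _ (h0.symm.trans _ _ _ (hmk h').symm)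

/-- Contracting the states at pairs of ends that are glued. -/
theorem sum_edgesWeight_glue (hβ : ∀ x y, β x y = β y x) {e d : I → T}
    (hcontr : ∀ x y, ∑ i, β x (d i) * β (e i) y = β x y) (hz : ∑ i, β (d i) (e i) = z) {n : ℕ} :
    ∀ {X C D : Type} [Finite X] [Finite C] [Finite D] {f : X → C} {s t : Fin n → C}
    (_ : TwoEnds (Sum.elim f (Sum.elim s t))) {π : C → D} (_ : Function.Surjective π)
    (_ : ∀ a b, π a = π b ↔ Relation.EqvGen (Glue s t) a b) (x : X → T),
    ∑ c : Fin n → I, edgesWeight β z (Sum.elim f (Sum.elim s t))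
      (Sum.elim x (Sum.elim (d ∘ c) (e ∘ c))) = edgesWeight β z (π ∘ f) x := by
  induction n with
  | zero =>
    intro X C D _ _ _ f s t hf π hsurj hπ x
    have heq : ∀ a b, Relation.EqvGen (Glue s t) a b → a = b := by
      intro a b h
      induction h with
      | rel x y h => obtain ⟨i⟩ := h; exact i.elim0
      | refl x => rfl
      | symm x y _ ih => exact ih.symm
      | trans x y z _ _ ih1 ih2 => exact ih1.trans ih2
    have hinj : Function.Injective π := fun a b h => heq a b ((hπ a b).1 h)
    rw [Fintype.sum_unique]
    refine edgesWeight_congr hβ hf (Equiv.sumEmpty X (Fin 0 ⊕ Fin 0))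
      (Equiv.ofBijective π ⟨hinj, hsurj⟩) ?_ ?_
    · rintro (a | i | i)
      · rfl
      · exact i.elim0
      · exact i.elim0
    · rintro (a | i | i)
      · rfl
      · exact i.elim0
      · exact i.elim0
  | succ n ih =>
    intro X C D _ _ _ f s t hf π hsurj hπ x
    -- The pairs of index at least one are glued first, by induction, while pair `0` is kept in `f₀`
    -- as two free ends; it is glued last.
    let s' : Fin n → C := fun i => s i.succ
    let t' : Fin n → C := fun i => t i.succ
    let f₀ : X ⊕ Unit ⊕ Unit → C := Sum.elim f (Sum.elim (fun _ => s 0) fun _ => t 0)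
    let E : (X ⊕ Unit ⊕ Unit) ⊕ Fin n ⊕ Fin n ≃ X ⊕ Fin (n + 1) ⊕ Fin (n + 1) :=
      { toFun := Sum.elim (Sum.elim Sum.inl (Sum.elim (fun _ => Sum.inr (Sum.inl 0))
            fun _ => Sum.inr (Sum.inr 0)))
          (Sum.elim (fun i => Sum.inr (Sum.inl i.succ)) fun i => Sum.inr (Sum.inr i.succ))
        invFun := Sum.elim (fun a => Sum.inl (Sum.inl a))
          (Sum.elim (Fin.cases (Sum.inl (Sum.inr (Sum.inl ()))) fun i => Sum.inr (Sum.inl i))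
            (Fin.cases (Sum.inl (Sum.inr (Sum.inr ()))) fun i => Sum.inr (Sum.inr i)))
        left_inv := by rintro ((a | a | a) | i | i) <;> rfl
        right_inv := by
          rintro (a | i | i)
          · rfl
          · induction i using Fin.cases <;> rfl
          · induction i using Fin.cases <;> rfl }
    have hE : ∀ a, Sum.elim f (Sum.elim s t) (E a) = Sum.elim f₀ (Sum.elim s' t') a := by
      rintro ((a | a | a) | i | i) <;> rfl
    have hf' : TwoEnds (Sum.elim f₀ (Sum.elim s' t')) := by
      refine TwoEnds.of_card fun c => ?_
      rw [card_fibre_congr E (g := Sum.elim f (Sum.elim s t)) (d := c) fun a => by rw [hE]]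
      exact hf.card c
    have hstep : ∀ (a : I) (c : Fin n → I),
        edgesWeight β z (Sum.elim f (Sum.elim s t))
          (Sum.elim x (Sum.elim (d ∘ (Fin.cons a c : Fin (n + 1) → I))
            (e ∘ (Fin.cons a c : Fin (n + 1) → I)))) =
        edgesWeight β z (Sum.elim f₀ (Sum.elim s' t'))
          (Sum.elim (Sum.elim x (Sum.elim (fun _ => d a) fun _ => e a))
            (Sum.elim (d ∘ c) (e ∘ c))) := by
      intro a c
      refine (edgesWeight_congr hβ hf' E (Equiv.refl _) hE ?_).symm
      rintro ((a | a | a) | i | i) <;> rfl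
    have hπ' : ∀ a b, Glue s' t' a b → π a = π b := by
      rintro _ _ ⟨i⟩
      exact (hπ _ _).2 (.rel _ _ (Glue.mk i.succ))
    rw [sum_fin_cons]
    simp only [hstep]
    have hih := fun a => ih hf' (π := Quot.mk (Glue s' t')) Quot.mk_surjective
      (fun a b => ⟨Quot.eqvGen_exact, Quot.eqvGen_sound⟩)
      (Sum.elim x (Sum.elim (fun _ => d a) fun _ => e a))
    simp only [hih]
    have hg : Quot.mk (Glue s' t') ∘ f₀ = Sum.elim (Quot.mk (Glue s' t') ∘ f)
        (Sum.elim (fun _ => Quot.mk _ (s 0)) fun _ => Quot.mk _ (t 0)) := by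
      funext a
      rcases a with a | a | a <;> rfl
    -- The partially glued edges again have two or no ends, as the gluing of the last pair requires.
    have hglue := card_glue f₀ s' t' hf'.card
    rw [hg]
    refine sum_edgesWeight_glue_pair hβ hcontr hz (by rw [← hg]; exact TwoEnds.of_card hglue)
      (π := Quot.lift π hπ') (fun K => ?_) ?_ x
    · obtain ⟨c, rfl⟩ := hsurj K
      exact ⟨Quot.mk _ c, rfl⟩
    · rintro ⟨a⟩ ⟨b⟩
      exact (hπ a b).trans (eqvGen_glue_succ_iff s t a b)

end Weight

/-! ### State sums -/

/-- The data from which the state sum of a graph is formed: a symmetric pairing of states, two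
dual families of states and symmetric functions of the states at a vertex. -/
structure StateSumData (k T I : Type*) [CommSemiring k] [Fintype I] [DecidableEq I] (r₀ : ℕ) where
  β : T → T → k
  symm : ∀ x y, β x y = β y x
  e : I → T
  d : I → T
  contract : ∀ x y, ∑ i, β x (d i) * β (e i) y = β x y
  dual : ∀ i j, β (e i) (d j) = if i = j then 1 else 0
  s : ∀ r : ℕ, r₀ ≤ r → (Fin r → T) → k
  s_symm : ∀ r hr (σ : Equiv.Perm (Fin r)) x, s r hr (x ∘ σ) = s r hr x

namespace StateSumData

variable {k T I : Type*} [CommSemiring k] [Fintype I] [DecidableEq I] {r₀ : ℕ}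
  (A : StateSumData k T I r₀) {V H V' H' : Type*}

/-- The weight of a vertex. -/
noncomputable def vertexWeight [Finite H] (f : H → V) (hf : ∀ v, r₀ ≤ Nat.card {h // f h = v})
    (x : H → T) (v : V) : k :=
  A.s _ (hf v) fun i => x ((Finite.equivFin {h // f h = v}).symm i).1

/-- Symmetry of `s` makes the weight independent of how the half-edges at the vertex are enumerated.
-/
theorem vertexWeight_eq [Finite H] {f : H → V} (hf : ∀ v, r₀ ≤ Nat.card {h // f h = v})
    {x : H → T} {v : V} {r : ℕ} (hr : r₀ ≤ r) (g : Fin r ≃ {h // f h = v}) :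
    A.vertexWeight f hf x v = A.s r hr fun i => x (g i).1 := by
  obtain rfl : Nat.card {h // f h = v} = r := by simpa using (Nat.card_congr g).symm
  rw [vertexWeight, ← A.s_symm _ _ (g.trans (Finite.equivFin _))]
  congr 1
  funext i
  simp

theorem vertexWeight_congr [Finite H] [Finite H'] {f : H → V} {f' : H' → V'}
    (hf : ∀ v, r₀ ≤ Nat.card {h // f h = v}) (hf' : ∀ v, r₀ ≤ Nat.card {h // f' h = v})
    {x : H → T} {x' : H' → T} {v : V} {v' : V'} (g : {h // f h = v} ≃ {h // f' h = v'})
    (hx : ∀ h, x' (g h).1 = x h.1) : A.vertexWeight f hf x v = A.vertexWeight f' hf' x' v' := by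
  rw [A.vertexWeight_eq hf' (hf v) ((Finite.equivFin _).symm.trans g), vertexWeight]
  simp [hx]

/-- The weight of the edges of a graph whose half-edges and end points are coloured. -/
noncomputable def edgesWeight {p q : ℕ} (Γ : TypedGraph r₀ p q) (c' : Fin q → I) (c : Fin p → I)
    (x : Γ.H → I) : k :=
  GraphProp.edgesWeight A.β (∑ i, A.β (A.d i) (A.e i)) (Sum.elim Γ.src (Sum.elim Γ.tgt Γ.leg))
    (Sum.elim (A.e ∘ c) (Sum.elim (A.d ∘ c') (A.d ∘ x)))

/-- The weight of the vertices of a graph whose half-edges are coloured. -/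
noncomputable def verticesWeight {p q : ℕ} (Γ : TypedGraph r₀ p q) (x : Γ.H → I) : k :=
  ∏ᶠ v, A.vertexWeight Γ.vert Γ.valence (A.e ∘ x) v

/-- The state sum of a graph, as a matrix indexed by colourings of the end points. -/
noncomputable def stateSum (p q : ℕ) (Γ : TypedGraph r₀ p q) : Matrix (Fin q → I) (Fin p → I) k :=
  fun c' c => ∑ᶠ x : Γ.H → I, A.edgesWeight Γ c' c x * A.verticesWeight Γ x

variable {p q r p' q' : ℕ}

theorem stateSum_iso {Γ Γ' : TypedGraph r₀ p q} (h : Γ ≈ Γ') :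
    A.stateSum p q Γ = A.stateSum p q Γ' := by
  obtain ⟨g⟩ := h
  ext c' c
  rw [stateSum, stateSum, ← finsum_comp_equiv (g.eH.arrowCongr (Equiv.refl I))]
  refine finsum_congr fun x => ?_
  congr 1
  · refine edgesWeight_congr A.symm Γ.twoEnds
      ((Equiv.refl _).sumCongr ((Equiv.refl _).sumCongr g.eH)) g.eE ?_ ?_
    · rintro (i | j | h)
      · exact g.src i
      · exact g.tgt j
      · exact g.leg h
    · rintro (i | j | h)
      · rfl
      · rfl
      · simp
  · rw [verticesWeight, verticesWeight, ← finprod_comp_equiv g.eV]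
    refine finprod_congr fun v => A.vertexWeight_congr _ _
      (g.eH.subtypeEquiv fun h => by rw [g.vert, g.eV.apply_eq_iff_eq]) fun h => ?_
    simp

theorem verticesWeight_sum {Γ : TypedGraph r₀ p q} {Φ : TypedGraph r₀ p' q'}
    {m n : ℕ} {Δ : TypedGraph r₀ m n} (eV : Γ.V ⊕ Φ.V ≃ Δ.V) (eH : Γ.H ⊕ Φ.H ≃ Δ.H)
    (h : ∀ x, Δ.vert (eH x) = eV (Sum.map Γ.vert Φ.vert x)) (x : Γ.H → I) (y : Φ.H → I)
    (w : Δ.H → I) (hw : ∀ a, w (eH a) = Sum.elim x y a) :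
    A.verticesWeight Δ w = A.verticesWeight Γ x * A.verticesWeight Φ y := by
  have := Fintype.ofFinite Γ.V
  have := Fintype.ofFinite Φ.V
  rw [verticesWeight, ← finprod_comp_equiv eV]
  simp only [verticesWeight, finprod_eq_prod_of_fintype, Fintype.prod_sum_type]
  congr 1
  · refine Finset.prod_congr rfl fun v _ => (A.vertexWeight_congr _ _ (Equiv.ofBijective
      (fun a => ⟨eH (Sum.inl a.1), by rw [h, Sum.map_inl, a.2]⟩) ⟨?_, ?_⟩) fun a => ?_).symm
    · intro a b hab
      exact Subtype.ext (Sum.inl_injective (eH.injective (congrArg Subtype.val hab)))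
    · rintro ⟨a, ha⟩
      obtain ⟨a | a, rfl⟩ := eH.surjective a
      · rw [h] at ha
        exact ⟨⟨a, Sum.inl_injective (eV.injective ha)⟩, rfl⟩
      · rw [h] at ha
        exact (Sum.inr_ne_inl (eV.injective ha)).elim
    · exact congrArg A.e (hw (Sum.inl a.1))
  · refine Finset.prod_congr rfl fun v _ => (A.vertexWeight_congr _ _ (Equiv.ofBijective
      (fun a => ⟨eH (Sum.inr a.1), by rw [h, Sum.map_inr, a.2]⟩) ⟨?_, ?_⟩) fun a => ?_).symm
    · intro a b hab
      exact Subtype.ext (Sum.inr_injective (eH.injective (congrArg Subtype.val hab)))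
    · rintro ⟨a, ha⟩
      obtain ⟨a | a, rfl⟩ := eH.surjective a
      · rw [h] at ha
        exact (Sum.inl_ne_inr (eV.injective ha)).elim
      · rw [h] at ha
        exact ⟨⟨a, Sum.inr_injective (eV.injective ha)⟩, rfl⟩
    · exact congrArg A.e (hw (Sum.inr a.1))

/-- Before gluing, the edges form a disjoint union and the weight is a product. A glued point of
colour `m i` carries the state `d (m i)` on the side of `Γ` and `e (m i)` on the side of `Φ`, so
summing over `m` is the contraction in `sum_edgesWeight_glue`. -/
theorem edgesWeight_comp (Φ : TypedGraph r₀ q r) (Γ : TypedGraph r₀ p q) (c' : Fin r → I)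
    (c : Fin p → I) (x : Γ.H → I) (y : Φ.H → I) :
    A.edgesWeight (Φ.comp Γ) c' c (Sum.elim x y) =
      ∑ m, A.edgesWeight Φ c' m y * A.edgesWeight Γ m c x := by
  let f : Fin p ⊕ Fin r ⊕ Γ.H ⊕ Φ.H → Γ.E ⊕ Φ.E := Sum.elim (fun i => Sum.inl (Γ.src i))
        (Sum.elim (fun j => Sum.inr (Φ.tgt j)) (Sum.map Γ.leg Φ.leg))
  let s : Fin q → Γ.E ⊕ Φ.E := fun i => Sum.inl (Γ.tgt i)
  let t : Fin q → Γ.E ⊕ Φ.E := fun i => Sum.inr (Φ.src i)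
  let E : (Fin p ⊕ Fin q ⊕ Γ.H) ⊕ (Fin q ⊕ Fin r ⊕ Φ.H) ≃
      (Fin p ⊕ Fin r ⊕ Γ.H ⊕ Φ.H) ⊕ Fin q ⊕ Fin q :=
    { toFun := Sum.elim
        (Sum.elim (fun i => Sum.inl (Sum.inl i)) (Sum.elim (fun i => Sum.inr (Sum.inl i))
          (fun h => Sum.inl (Sum.inr (Sum.inr (Sum.inl h))))))
        (Sum.elim (fun i => Sum.inr (Sum.inr i)) (Sum.elim
          (fun j => Sum.inl (Sum.inr (Sum.inl j)))
          (fun h => Sum.inl (Sum.inr (Sum.inr (Sum.inr h))))))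
      invFun := Sum.elim (Sum.elim (fun i => Sum.inl (Sum.inl i)) (Sum.elim
        (fun j => Sum.inr (Sum.inr (Sum.inl j)))
        (Sum.elim (fun h => Sum.inl (Sum.inr (Sum.inr h)))
          (fun h => Sum.inr (Sum.inr (Sum.inr h))))))
        (Sum.elim (fun i => Sum.inl (Sum.inr (Sum.inl i))) (fun i => Sum.inr (Sum.inl i)))
      left_inv := by rintro ((i | i | h) | i | j | h) <;> rfl
      right_inv := by rintro ((i | j | h | h) | i | i) <;> rfl }
  have hE : ∀ a, Sum.elim f (Sum.elim s t) (E a) = Sum.map (Sum.elim Γ.src (Sum.elim Γ.tgt Γ.leg))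
      (Sum.elim Φ.src (Sum.elim Φ.tgt Φ.leg)) a := by
    rintro ((i | i | h) | i | j | h) <;> rfl
  have hmap : TwoEnds (Sum.map (Sum.elim Γ.src (Sum.elim Γ.tgt Γ.leg))
      (Sum.elim Φ.src (Sum.elim Φ.tgt Φ.leg))) :=
    TwoEnds.of_card (TypedGraph.card_sum_sum _ _ (Equiv.refl _) _ (fun _ => rfl) Γ.two_ends
      Φ.two_ends)
  have hf : TwoEnds (Sum.elim f (Sum.elim s t)) := by
    refine TwoEnds.of_card fun c => ?_
    rw [← card_fibre_congr E (c := c) fun a => by rw [hE]]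
    exact hmap.card c
  have hcomp : Sum.elim (Φ.comp Γ).src (Sum.elim (Φ.comp Γ).tgt (Φ.comp Γ).leg) =
      Quot.mk (Glue s t) ∘ f := by
    funext a
    rcases a with i | j | h <;> rfl
  unfold edgesWeight
  rw [hcomp]
  refine (sum_edgesWeight_glue A.symm A.contract rfl hf (π := Quot.mk (Glue s t))
    Quot.mk_surjective (fun a b => ⟨Quot.eqvGen_exact, Quot.eqvGen_sound⟩) _).symm.trans ?_
  refine Finset.sum_congr rfl fun m _ => ?_
  rw [mul_comm, ← edgesWeight_sum A.symm Γ.twoEnds Φ.twoEnds]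
  refine (edgesWeight_congr A.symm hmap E (Equiv.refl _) hE ?_).symm
  rintro ((i | i | h) | i | j | h) <;> rfl

theorem verticesWeight_comp (Φ : TypedGraph r₀ q r) (Γ : TypedGraph r₀ p q) (x : Γ.H → I)
    (y : Φ.H → I) : A.verticesWeight (Φ.comp Γ) (Sum.elim x y) =
      A.verticesWeight Γ x * A.verticesWeight Φ y :=
  A.verticesWeight_sum (Equiv.refl (Γ.V ⊕ Φ.V)) (Equiv.refl (Γ.H ⊕ Φ.H)) (fun _ => rfl) x y _
    fun _ => rfl

theorem verticesWeight_tensor (Γ : TypedGraph r₀ p q) (Φ : TypedGraph r₀ p' q') (x : Γ.H → I)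
    (y : Φ.H → I) : A.verticesWeight (Γ.tensor Φ) (Sum.elim x y) =
      A.verticesWeight Γ x * A.verticesWeight Φ y :=
  A.verticesWeight_sum (Equiv.refl (Γ.V ⊕ Φ.V)) (Equiv.refl (Γ.H ⊕ Φ.H)) (fun _ => rfl) x y _
    fun _ => rfl

theorem edgesWeight_tensor (Γ : TypedGraph r₀ p q) (Φ : TypedGraph r₀ p' q') (c' : Fin (q + q') → I)
    (c : Fin (p + p') → I) (x : Γ.H → I) (y : Φ.H → I) :
    A.edgesWeight (Γ.tensor Φ) c' c (Sum.elim x y) =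
      A.edgesWeight Γ (c' ∘ Fin.castAdd q') (c ∘ Fin.castAdd p') x *
        A.edgesWeight Φ (c' ∘ Fin.natAdd q) (c ∘ Fin.natAdd p) y := by
  unfold edgesWeight
  rw [← edgesWeight_sum A.symm Γ.twoEnds Φ.twoEnds]
  let E : (Fin p ⊕ Fin q ⊕ Γ.H) ⊕ (Fin p' ⊕ Fin q' ⊕ Φ.H) ≃
      Fin (p + p') ⊕ Fin (q + q') ⊕ Γ.H ⊕ Φ.H :=
    { toFun := Sum.elim (Sum.elim (fun i => Sum.inl (Sum.inl i)) (Sum.elim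
          (fun j => Sum.inr (Sum.inl (Sum.inl j))) (fun h => Sum.inr (Sum.inr (Sum.inl h)))))
        (Sum.elim (fun i => Sum.inl (Sum.inr i)) (Sum.elim
          (fun j => Sum.inr (Sum.inl (Sum.inr j))) (fun h => Sum.inr (Sum.inr (Sum.inr h)))))
      invFun := Sum.elim (Sum.elim (fun i => Sum.inl (Sum.inl i)) (fun i => Sum.inr (Sum.inl i)))
        (Sum.elim (Sum.elim (fun j => Sum.inl (Sum.inr (Sum.inl j)))
            (fun j => Sum.inr (Sum.inr (Sum.inl j))))
          (Sum.elim (fun h => Sum.inl (Sum.inr (Sum.inr h)))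
            (fun h => Sum.inr (Sum.inr (Sum.inr h)))))
      left_inv := by rintro ((i | i | h) | i | j | h) <;> rfl
      right_inv := by rintro ((i | i) | (j | j) | h | h) <;> rfl :
        _ ≃ (Fin p ⊕ Fin p') ⊕ (Fin q ⊕ Fin q') ⊕ Γ.H ⊕ Φ.H }.trans
      (finSumFinEquiv.sumCongr (finSumFinEquiv.sumCongr (Equiv.refl _)))
  refine (edgesWeight_congr A.symm (TwoEnds.of_card (TypedGraph.card_sum_sum _ _ (Equiv.refl _) _
    (fun _ => rfl) Γ.two_ends Φ.two_ends)) E (Equiv.refl _) ?_ ?_).symm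
  · rintro ((i | i | h) | i | j | h) <;> simp [E, TypedGraph.tensor]
  · rintro ((i | i | h) | i | j | h) <;> simp [E] <;> rfl

theorem stateSum_eq_sum_sum {Δ : TypedGraph r₀ p q} {HA HB : Type} [Fintype HA] [Fintype HB]
    [DecidableEq HA] [DecidableEq HB] (eH : HA ⊕ HB ≃ Δ.H) (c' : Fin q → I) (c : Fin p → I) :
    A.stateSum p q Δ c' c = ∑ x : HA → I, ∑ y : HB → I,
      A.edgesWeight Δ c' c (Sum.elim x y ∘ eH.symm) *
        A.verticesWeight Δ (Sum.elim x y ∘ eH.symm) := by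
  rw [stateSum, ← finsum_comp_equiv ((Equiv.sumArrowEquivProdArrow HA HB I).symm.trans
    (eH.arrowCongr (Equiv.refl I))), finsum_eq_sum_of_fintype, Fintype.sum_prod_type]
  rfl

/-- Colourings of the half-edges of the composite are pairs of colourings, and vertex weights
multiply. The sum over colours of the glued points, which comes from the edges, is that of the
matrix product. -/
theorem stateSum_comp (Φ : TypedGraph r₀ q r) (Γ : TypedGraph r₀ p q) :
    A.stateSum p r (Φ.comp Γ) = A.stateSum q r Φ * A.stateSum p q Γ := by
  classical
  have := Fintype.ofFinite Γ.H
  have := Fintype.ofFinite Φ.H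
  ext c' c
  rw [Matrix.mul_apply, A.stateSum_eq_sum_sum (Equiv.refl _ : Γ.H ⊕ Φ.H ≃ (Φ.comp Γ).H)]
  have h1 : ∀ (x : Γ.H → I) (y : Φ.H → I),
      A.edgesWeight (Φ.comp Γ) c' c (Sum.elim x y) * A.verticesWeight (Φ.comp Γ) (Sum.elim x y) =
      ∑ m, (A.edgesWeight Φ c' m y * A.verticesWeight Φ y) *
        (A.edgesWeight Γ m c x * A.verticesWeight Γ x) := by
    intro x y
    refine (congrArg₂ (· * ·) (A.edgesWeight_comp Φ Γ c' c x y)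
      (A.verticesWeight_comp Φ Γ x y)).trans ?_
    rw [Finset.sum_mul]
    exact Finset.sum_congr rfl fun m _ => by ring
  simp only [stateSum, finsum_eq_sum_of_fintype, Finset.sum_mul_sum]
  refine (Finset.sum_congr rfl fun x _ => Finset.sum_congr rfl fun y _ => h1 x y).trans ?_
  rw [Finset.sum_comm]
  refine (Finset.sum_congr rfl fun y _ => Finset.sum_comm).trans ?_
  rw [Finset.sum_comm]

theorem stateSum_tensor (Γ : TypedGraph r₀ p q) (Φ : TypedGraph r₀ p' q') (c' : Fin (q + q') → I)
    (c : Fin (p + p') → I) : A.stateSum (p + p') (q + q') (Γ.tensor Φ) c' c =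
      A.stateSum p q Γ (c' ∘ Fin.castAdd q') (c ∘ Fin.castAdd p') *
        A.stateSum p' q' Φ (c' ∘ Fin.natAdd q) (c ∘ Fin.natAdd p) := by
  classical
  have := Fintype.ofFinite Γ.H
  have := Fintype.ofFinite Φ.H
  rw [A.stateSum_eq_sum_sum (Equiv.refl _ : Γ.H ⊕ Φ.H ≃ (Γ.tensor Φ).H)]
  simp only [stateSum, finsum_eq_sum_of_fintype, Finset.sum_mul_sum]
  refine Finset.sum_congr rfl fun x _ => Finset.sum_congr rfl fun y _ => ?_
  exact (congrArg₂ (· * ·) (A.edgesWeight_tensor Γ Φ c' c x y)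
    (A.verticesWeight_tensor Γ Φ x y)).trans (mul_mul_mul_comm _ _ _ _)

theorem edgesWeight_eq_prod {Γ : TypedGraph r₀ p q} {c' : Fin q → I} {c : Fin p → I} {x : Γ.H → I}
    {a b : Γ.E → Fin p ⊕ Fin q ⊕ Γ.H}
    (h : ∀ i, IsEndPair (Sum.elim Γ.src (Sum.elim Γ.tgt Γ.leg)) i (a i) (b i)) :
    A.edgesWeight Γ c' c x =
      ∏ᶠ i, A.β (Sum.elim (A.e ∘ c) (Sum.elim (A.d ∘ c') (A.d ∘ x)) (a i))
        (Sum.elim (A.e ∘ c) (Sum.elim (A.d ∘ c') (A.d ∘ x)) (b i)) :=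
  finprod_congr fun i => edgeWeight_of_pair A.symm (h i)

theorem verticesWeight_of_isEmpty {Γ : TypedGraph r₀ p q} [IsEmpty Γ.V] (x : Γ.H → I) :
    A.verticesWeight Γ x = 1 :=
  finprod_of_isEmpty _

theorem stateSum_strands {m n : ℕ} (e : Fin m ≃ Fin n) (c' : Fin n → I) (c : Fin m → I) :
    A.stateSum m n (TypedGraph.strands r₀ e) c' c = if c = c' ∘ e then 1 else 0 := by
  have hV : IsEmpty (TypedGraph.strands r₀ e).V := inferInstanceAs (IsEmpty Empty)
  have hH : IsEmpty (TypedGraph.strands r₀ e).H := inferInstanceAs (IsEmpty Empty)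
  rw [stateSum, finsum_unique, A.verticesWeight_of_isEmpty, mul_one,
    A.edgesWeight_eq_prod (a := fun i : Fin m => Sum.inl i)
      (b := fun i : Fin m => Sum.inr (Sum.inl (e i)))]
  · change ∏ᶠ i : Fin m, A.β (A.e (c i)) (A.d (c' (e i))) = _
    rw [finprod_eq_prod_of_fintype]
    simp only [A.dual]
    rw [Fintype.prod_ite_zero]
    simp [funext_iff]
  · intro i
    refine ⟨Sum.inl_ne_inr, rfl, e.symm_apply_apply i, ?_⟩
    rintro (j | j | h) hj
    · exact Or.inl (congrArg Sum.inl hj)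
    · exact Or.inr (congrArg (fun j => Sum.inr (Sum.inl j)) (e.symm_apply_eq.1 hj))
    · exact h.elim

theorem stateSum_cap (i j : I) :
    A.stateSum 2 0 (TypedGraph.cap r₀) ![] ![i, j] = A.β (A.e i) (A.e j) := by
  have hV : IsEmpty (TypedGraph.cap r₀).V := inferInstanceAs (IsEmpty Empty)
  have hH : IsEmpty (TypedGraph.cap r₀).H := inferInstanceAs (IsEmpty Empty)
  have hE : Unique (TypedGraph.cap r₀).E := inferInstanceAs (Unique Unit)
  rw [stateSum, finsum_unique, A.verticesWeight_of_isEmpty, mul_one,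
    A.edgesWeight_eq_prod (a := fun _ => Sum.inl 0) (b := fun _ => Sum.inl 1), finprod_unique]
  · rfl
  · intro x
    refine ⟨by simp, rfl, rfl, ?_⟩
    rintro (j | j | h) -
    · fin_cases j
      · exact Or.inl rfl
      · exact Or.inr rfl
    · exact j.elim0
    · exact h.elim

/-- By duality each edge contributes a Kronecker delta between the colours of its end point and its
half-edge, so only the colouring `c` of the half-edges survives. -/
theorem stateSum_corolla (hr : r₀ ≤ r) (c : Fin r → I) :
    A.stateSum r 0 (TypedGraph.corolla r₀ r hr) ![] c = A.s r hr (A.e ∘ c) := by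
  have hV : Unique (TypedGraph.corolla r₀ r hr).V := inferInstanceAs (Unique Unit)
  have h : ∀ x : Fin r → I, A.edgesWeight (TypedGraph.corolla r₀ r hr) ![] c x =
      if c = x then 1 else 0 := by
    intro x
    refine (A.edgesWeight_eq_prod (Γ := TypedGraph.corolla r₀ r hr)
      (a := fun i : Fin r => Sum.inl i)
      (b := fun i : Fin r => Sum.inr (Sum.inr i)) fun i => ?_).trans ?_
    · refine ⟨Sum.inl_ne_inr, rfl, rfl, ?_⟩
      rintro (j | j | j) hj
      · exact Or.inl (congrArg Sum.inl hj)
      · exact j.elim0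
      · exact Or.inr (congrArg (fun j => Sum.inr (Sum.inr j)) hj)
    · change ∏ᶠ i : Fin r, A.β (A.e (c i)) (A.d (x i)) = _
      rw [finprod_eq_prod_of_fintype]
      simp only [A.dual]
      rw [Fintype.prod_ite_zero]
      simp [funext_iff]
  refine (finsum_eq_single _ c fun x hx => ?_).trans ?_
  · exact (congrArg (· * _) ((h x).trans (if_neg (Ne.symm hx)))).trans (zero_mul _)
  · refine (congrArg (· * _) ((h c).trans (if_pos rfl))).trans ((one_mul _).trans ?_)
    refine (finprod_unique _).trans ?_
    exact A.vertexWeight_eq _ hr (Equiv.subtypeUnivEquiv fun _ => rfl).symm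

end StateSumData

theorem StateSumData.isMatrixProp {k T I : Type*} [Field k] [Fintype I] [DecidableEq I] {r₀ : ℕ}
    (A : StateSumData k T I r₀) : IsMatrixProp A.stateSum where
  iso := A.stateSum_iso
  comp := A.stateSum_comp
  tensor := A.stateSum_tensor
  id n := by
    ext c' c
    rw [TypedGraph.id, A.stateSum_strands, Matrix.one_apply]
    exact if_congr eq_comm rfl rfl
  braiding m n c' c := A.stateSum_strands _ c' c


/-! ### Passage between operators and matrices -/

section Translation

variable {k : Type*} [Field k] {V : Type*} [AddCommGroup V] [Module k V] {I : Type*}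
  (B : Module.Basis I k V) {r₀ : ℕ}

namespace CG

variable (k) {p q r p' q' : ℕ}

theorem comp_of (Φ : TypedGraph r₀ q r) (Γ : TypedGraph r₀ p q) :
    comp k (of k Φ) (of k Γ) = of k (Φ.comp Γ) := by
  simp [comp, of, GraphClass.comp, GraphClass.mk]

theorem tensor_of (Γ : TypedGraph r₀ p q) (Φ : TypedGraph r₀ p' q') :
    tensor k (of k Γ) (of k Φ) = of k (Γ.tensor Φ) := by
  simp [tensor, of, GraphClass.tensor, GraphClass.mk]

variable {k}

/-- Two linear maps on a hom-space agree if they agree on graphs. -/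
theorem hom_ext {W : Type*} [AddCommGroup W] [Module k W] {f g : CG k r₀ p q →ₗ[k] W}
    (h : ∀ Γ, f (of k Γ) = g (of k Γ)) : f = g := by
  refine Finsupp.lhom_ext' fun G => LinearMap.ext_ring ?_
  induction G using Quotient.inductionOn with
  | _ Γ => exact h Γ

end CG

/-- The basis of a tensor power that is induced by a basis. -/
noncomputable def tensorBasis (n : ℕ) : Module.Basis (Fin n → I) k (⨂[k]^n V) :=
  Basis.piTensorProduct fun _ => B

theorem tensorBasis_apply {n : ℕ} (c : Fin n → I) :
    tensorBasis B n c = PiTensorProduct.tprod k fun i => B (c i) :=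
  Basis.piTensorProduct_apply _ _

theorem tensorBasis_repr_tprod {n : ℕ} (x : Fin n → V) (c : Fin n → I) :
    (tensorBasis B n).repr (PiTensorProduct.tprod k x) c = ∏ i, B.repr (x i) (c i) :=
  Basis.piTensorProduct_repr_tprod_apply _ _ _

theorem mulEquiv_tprod {m n : ℕ} (a : Fin m → V) (b : Fin n → V) :
    TensorPower.mulEquiv (PiTensorProduct.tprod k a ⊗ₜ[k] PiTensorProduct.tprod k b) =
      PiTensorProduct.tprod k (Fin.append a b) :=
  TensorPower.tprod_mul_tprod k a b

theorem tensorBasis_repr_mulEquiv {m n : ℕ} (x : ⨂[k]^m V) (y : ⨂[k]^n V) (c : Fin (m + n) → I) :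
    (tensorBasis B (m + n)).repr (TensorPower.mulEquiv (x ⊗ₜ[k] y)) c =
      (tensorBasis B m).repr x (c ∘ Fin.castAdd n) *
        (tensorBasis B n).repr y (c ∘ Fin.natAdd m) := by
  induction x using PiTensorProduct.induction_on with
  | add x x' hx hx' =>
    simp only [TensorProduct.add_tmul, map_add, Finsupp.add_apply, hx, hx', add_mul]
  | smul_tprod a x =>
    induction y using PiTensorProduct.induction_on with
    | add y y' hy hy' =>
      simp only [TensorProduct.tmul_add, map_add, Finsupp.add_apply, hy, hy', mul_add]
    | smul_tprod b y =>
      rw [TensorProduct.smul_tmul_smul, map_smul, mulEquiv_tprod]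
      simp only [map_smul, Finsupp.smul_apply, tensorBasis_repr_tprod, Fin.prod_univ_add,
        Fin.append_left, Fin.append_right, smul_eq_mul, Function.comp_apply]
      ring

theorem reindex_tensorBasis {m n : ℕ} (e : Fin m ≃ Fin n) (c : Fin m → I) :
    PiTensorProduct.reindex k (fun _ => V) e (tensorBasis B m c) =
      tensorBasis B n (c ∘ e.symm) := by
  rw [tensorBasis_apply, tensorBasis_apply]
  exact PiTensorProduct.reindex_tprod e _

variable [Fintype I] [DecidableEq I]

theorem toMatrix_tensor {m n m' n' : ℕ} (f : EndProp k V m n) (g : EndProp k V m' n')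
    (c' : Fin (n + n') → I) (c : Fin (m + m') → I) :
    LinearMap.toMatrix (tensorBasis B (m + m')) (tensorBasis B (n + n'))
        (EndProp.tensor k V f g) c' c =
      LinearMap.toMatrix (tensorBasis B m) (tensorBasis B n) f (c' ∘ Fin.castAdd n')
          (c ∘ Fin.castAdd m') *
        LinearMap.toMatrix (tensorBasis B m') (tensorBasis B n') g (c' ∘ Fin.natAdd n)
          (c ∘ Fin.natAdd m) := by
  have h : TensorPower.mulEquiv.symm (tensorBasis B (m + m') c) =
      tensorBasis B m (c ∘ Fin.castAdd m') ⊗ₜ[k] tensorBasis B m' (c ∘ Fin.natAdd m) := by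
    rw [LinearEquiv.symm_apply_eq, tensorBasis_apply, tensorBasis_apply, tensorBasis_apply,
      mulEquiv_tprod]
    congr 1
    funext i
    refine Fin.addCases (fun i => ?_) (fun i => ?_) i <;> simp
  simp only [LinearMap.toMatrix_apply]
  rw [← tensorBasis_repr_mulEquiv, EndProp.tensor]
  simp only [LinearMap.comp_apply, LinearEquiv.coe_coe, h, TensorProduct.map_tmul]

theorem toMatrix_braiding (m n : ℕ) (c' : Fin (n + m) → I) (c : Fin (m + n) → I) :
    LinearMap.toMatrix (tensorBasis B (m + n)) (tensorBasis B (n + m)) (EndProp.braiding k V m n)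
      c' c = if c = c' ∘ finAddFlip then 1 else 0 := by
  rw [LinearMap.toMatrix_apply, EndProp.braiding, LinearEquiv.coe_coe, reindex_tensorBasis,
    Module.Basis.repr_self, Finsupp.single_apply]
  refine if_congr ?_ rfl rfl
  rw [Equiv.comp_symm_eq]

/-- The matrices of the operators of graphs. -/
noncomputable def CGAlgebra.matrix (Z : CGAlgebra k V r₀) (p q : ℕ) (Γ : TypedGraph r₀ p q) :
    Matrix (Fin q → I) (Fin p → I) k :=
  LinearMap.toMatrix (tensorBasis B p) (tensorBasis B q) (Z.toMap p q (CG.of k Γ))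

theorem CGAlgebra.isMatrixProp (Z : CGAlgebra k V r₀) : IsMatrixProp (Z.matrix B) where
  iso h := by
    have : GraphClass.mk _ = GraphClass.mk _ := Quotient.sound h
    rw [matrix, matrix, CG.of, CG.of, this]
  comp Φ Γ := by
    rw [matrix, ← CG.comp_of, Z.map_comp, LinearMap.toMatrix_comp _ (tensorBasis B _)]
    rfl
  tensor Γ Φ c' c := by
    rw [matrix, ← CG.tensor_of, Z.map_tensor, toMatrix_tensor]
    rfl
  id n := by rw [matrix, Z.map_id, LinearMap.toMatrix_id]
  braiding m n c' c := by rw [matrix, Z.map_braiding, toMatrix_braiding]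

/-- The algebra over the PROP of graphs that is given by matrices. -/
noncomputable def IsMatrixProp.toCGAlgebra
    {M : ∀ p q : ℕ, TypedGraph r₀ p q → Matrix (Fin q → I) (Fin p → I) k} (hM : IsMatrixProp M) :
    CGAlgebra k V r₀ :=
  let t : ∀ p q : ℕ, CG k r₀ p q →ₗ[k] EndProp k V p q := fun p q =>
    Finsupp.linearCombination k (Quotient.lift
      (fun Γ => Matrix.toLin (tensorBasis B p) (tensorBasis B q) (M p q Γ))
      fun _ _ h => congrArg _ (hM.iso h))
  have ht : ∀ {p q : ℕ} (Γ : TypedGraph r₀ p q), t p q (CG.of k Γ) =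
      Matrix.toLin (tensorBasis B p) (tensorBasis B q) (M p q Γ) := fun Γ => by
    simp only [t, CG.of, Finsupp.linearCombination_single, one_smul]
    rfl
  { toMap := t
    map_comp := fun {p q r} Φ Γ => by
      have h : (CG.comp k).compr₂ (t p r) =
          (LinearMap.llcomp k (⨂[k]^p V) (⨂[k]^q V) (⨂[k]^r V)).compl₁₂ (t q r) (t p q) := by
        refine CG.hom_ext fun Φ => CG.hom_ext fun Γ => ?_
        simp only [LinearMap.compr₂_apply, LinearMap.compl₁₂_apply, CG.comp_of, ht, hM.comp]
        rw [Matrix.toLin_mul (tensorBasis B p) (tensorBasis B q) (tensorBasis B r),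
          LinearMap.llcomp_apply']
      exact LinearMap.congr_fun (LinearMap.congr_fun h Φ) Γ
    map_tensor := fun {p q p' q'} Γ Φ => by
      -- `EndProp.tensor` is a plain function of two operators, so bilinearity is unfolded in each
      -- argument to reduce to single graphs.
      induction Γ using Finsupp.induction_linear with
      | zero => simp [EndProp.tensor]
      | add Γ Γ' h h' =>
        simp only [map_add, LinearMap.add_apply, h, h', EndProp.tensor, TensorProduct.map_add_left,
          LinearMap.add_comp, LinearMap.comp_add]
      | single G a =>
        induction Φ using Finsupp.induction_linear with
        | zero => simp [EndProp.tensor]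
        | add Γ Γ' h h' =>
          simp only [map_add, h, h', EndProp.tensor, TensorProduct.map_add_right,
            LinearMap.add_comp, LinearMap.comp_add]
        | single G' a' =>
          induction G using Quotient.inductionOn with
          | _ Γ =>
          induction G' using Quotient.inductionOn with
          | _ Φ =>
          have h1 : (Finsupp.single (Quotient.mk _ Γ) a : CG k r₀ p q) = a • CG.of k Γ := by
            simp [CG.of, GraphClass.mk]
          have h2 : (Finsupp.single (Quotient.mk _ Φ) a' : CG k r₀ p' q') = a' • CG.of k Φ := by
            simp [CG.of, GraphClass.mk]
          have h3 : t (p + p') (q + q') (CG.of k (Γ.tensor Φ)) =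
              EndProp.tensor k V (t p q (CG.of k Γ)) (t p' q' (CG.of k Φ)) := by
            apply (LinearMap.toMatrix (tensorBasis B (p + p')) (tensorBasis B (q + q'))).injective
            ext c' c
            rw [toMatrix_tensor, ht, ht, ht, LinearMap.toMatrix_toLin, LinearMap.toMatrix_toLin,
              LinearMap.toMatrix_toLin, hM.tensor]
          rw [h1, h2]
          simp only [map_smul, LinearMap.smul_apply, CG.tensor_of, h3, EndProp.tensor,
            TensorProduct.map_smul_left, TensorProduct.map_smul_right, LinearMap.smul_comp,
            LinearMap.comp_smul]
    map_id := fun n => by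
      rw [ht, hM.id, Matrix.toLin_one]
    map_braiding := fun m n => by
      apply (LinearMap.toMatrix (tensorBasis B (m + n)) (tensorBasis B (n + m))).injective
      ext c' c
      rw [toMatrix_braiding, ht, LinearMap.toMatrix_toLin, hM.braiding] }

theorem IsMatrixProp.matrix_toCGAlgebra
    {M : ∀ p q : ℕ, TypedGraph r₀ p q → Matrix (Fin q → I) (Fin p → I) k} (hM : IsMatrixProp M)
    {p q : ℕ} (Γ : TypedGraph r₀ p q) : (hM.toCGAlgebra B).matrix B p q Γ = M p q Γ := by
  have h : (hM.toCGAlgebra B).toMap p q (CG.of k Γ) =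
      Matrix.toLin (tensorBasis B p) (tensorBasis B q) (M p q Γ) := by
    simp only [toCGAlgebra, CG.of, Finsupp.linearCombination_single, one_smul]
    rfl
  rw [CGAlgebra.matrix, h, LinearMap.toMatrix_toLin]

theorem CGAlgebra.functional_tensorBasis (Z : CGAlgebra k V r₀) {p : ℕ} (Γ : TypedGraph r₀ p 0)
    (c : Fin p → I) : Z.functional Γ (tensorBasis B p c) = Z.matrix B p 0 Γ ![] c := by
  -- The zeroth tensor power has one basis vector, indexed by the empty colouring, and its
  -- identification with `k` is the corresponding coordinate.
  have h : (PiTensorProduct.isEmptyEquiv (Fin 0)).toLinearMap =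
      Finsupp.lapply ![] ∘ₗ (tensorBasis B 0).repr.toLinearMap := by
    refine (tensorBasis B 0).ext fun c => ?_
    obtain rfl : c = ![] := Subsingleton.elim _ _
    simp only [LinearMap.comp_apply, LinearEquiv.coe_coe, Module.Basis.repr_self,
      Finsupp.lapply_apply, Finsupp.single_eq_same]
    rw [tensorBasis_apply, PiTensorProduct.isEmptyEquiv_apply_tprod]
  rw [functional, h, matrix, LinearMap.toMatrix_apply]
  rfl

/-- The value of an algebra over the PROP of graphs on the arc, as a bilinear form. -/
noncomputable def CGAlgebra.form (Z : CGAlgebra k V r₀) : LinearMap.BilinForm k V :=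
  let f := ((Z.functional (TypedGraph.cap r₀)).compMultilinearMap (PiTensorProduct.tprod k))
  LinearMap.mk₂ k (fun x y => f ![x, y]) (fun x x' y => f.cons_add ![y] x x')
    (fun a x y => f.cons_smul ![y] a x) (fun x y y' => (f.curryLeft x).cons_add ![] y y')
    (fun a x y => (f.curryLeft x).cons_smul ![] a y)

theorem CGAlgebra.form_apply (Z : CGAlgebra k V r₀) (x y : V) :
    Z.form x y = Z.functional (TypedGraph.cap r₀) (PiTensorProduct.tprod k ![x, y]) :=
  rfl

theorem CGAlgebra.form_basis (Z : CGAlgebra k V r₀) (i j : I) :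
    Z.form (B i) (B j) = Z.matrix B 2 0 (TypedGraph.cap r₀) ![] ![i, j] := by
  rw [← Z.functional_tensorBasis, form_apply, tensorBasis_apply]
  congr 2
  funext x
  fin_cases x <;> rfl

/-- Both sides are linear forms, so it suffices to compare them on the tensor basis, where
`corolla_symm` applies. Reindexing by `σ.symm` is what turns `X` into `X ∘ σ`. -/
theorem CGAlgebra.functional_corolla_tprod (B : Module.Basis I k V)
    (Z : CGAlgebra k V r₀) {r : ℕ} (hr : r₀ ≤ r)
    (σ : Equiv.Perm (Fin r)) (X : Fin r → V) :
    Z.functional (TypedGraph.corolla r₀ r hr) (PiTensorProduct.tprod k X) =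
      Z.functional (TypedGraph.corolla r₀ r hr) (PiTensorProduct.tprod k fun i => X (σ i)) := by
  have h : Z.functional (TypedGraph.corolla r₀ r hr) =
      Z.functional (TypedGraph.corolla r₀ r hr) ∘ₗ
        (PiTensorProduct.reindex k (fun _ => V) σ.symm).toLinearMap := by
    refine (tensorBasis B r).ext fun c => ?_
    rw [LinearMap.comp_apply, LinearEquiv.coe_coe, reindex_tensorBasis, functional_tensorBasis,
      functional_tensorBasis]
    exact ((Z.isMatrixProp B).corolla_symm hr σ c).symm
  rw [h, LinearMap.comp_apply, LinearEquiv.coe_coe, PiTensorProduct.reindex_tprod, ← h]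
  rfl

end Translation

/-! ### The bijection -/

/-- The symmetric algebra structure defined by an algebra over the PROP of graphs. -/
noncomputable def CGAlgebra.toSymmetricAlgebraStructure {k : Type*} [Field k] {V : Type*}
    [AddCommGroup V] [Module k V] [FiniteDimensional k V] {r₀ : ℕ} (Z : CGAlgebra k V r₀) :
    SymmetricAlgebraStructure k V r₀ where
  b := Z.form
  b_symm := by
    refine ⟨fun x y => ?_⟩
    have h : Z.form = Z.form.flip := by
      refine LinearMap.BilinForm.ext_basis (Module.finBasis k V) fun i j => ?_
      rw [LinearMap.BilinForm.flip_apply, Z.form_basis, Z.form_basis]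
      exact (Z.isMatrixProp _).cap_symm i j
    conv_lhs => rw [h]
    rfl
  b_nondegenerate := by
    refine LinearMap.BilinForm.nondegenerate_of_det_ne_zero _ (Module.finBasis k V) ?_
    -- The Gram matrix of the form is the matrix of `cap`, and that of `cup` is a right inverse.
    have h := (Z.isMatrixProp (Module.finBasis k V)).cap_mul_cup
    have h' : LinearMap.BilinForm.toMatrix (Module.finBasis k V) Z.form = Matrix.of fun i j =>
        Z.matrix (Module.finBasis k V) 2 0 (TypedGraph.cap r₀) ![] ![i, j] := by
      ext i j
      rw [LinearMap.BilinForm.toMatrix_apply, Z.form_basis]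
      rfl
    rw [h']
    exact Matrix.det_ne_zero_of_right_inverse h
  S r hr := Z.functional (TypedGraph.corolla r₀ r hr)
  S_symm r hr σ X := CGAlgebra.functional_corolla_tprod (Module.finBasis k V) Z hr σ X

/-- `b` and `S` are the matrix entries on `cap` and the corollas, and by `IsMatrixProp.ext` these
determine the matrices of all graphs, which span the hom-spaces. -/
theorem CGAlgebra.toSymmetricAlgebraStructure_injective {k : Type*} [Field k] {V : Type*}
    [AddCommGroup V] [Module k V] [FiniteDimensional k V] {r₀ : ℕ} :
    Function.Injective (toSymmetricAlgebraStructure : CGAlgebra k V r₀ → _) := by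
  intro Z Z' h
  let B := Module.finBasis k V
  have hb : Z.form = Z'.form := congrArg SymmetricAlgebraStructure.b h
  have hS : ∀ r (hr : r₀ ≤ r), Z.functional (TypedGraph.corolla r₀ r hr) =
      Z'.functional (TypedGraph.corolla r₀ r hr) := fun r hr =>
    congrFun (congrFun (congrArg SymmetricAlgebraStructure.S h) r) hr
  have hM : ∀ {p q : ℕ} (Γ : TypedGraph r₀ p q), Z.matrix B p q Γ = Z'.matrix B p q Γ := by
    refine (Z.isMatrixProp B).ext (Z'.isMatrixProp B) ?_ fun r hr => ?_
    · ext c' c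
      obtain rfl : c' = ![] := Subsingleton.elim _ _
      have hc : c = ![c 0, c 1] := by
        funext x
        fin_cases x <;> rfl
      rw [hc, ← form_basis, ← form_basis, hb]
    · ext c' c
      obtain rfl : c' = ![] := Subsingleton.elim _ _
      rw [← functional_tensorBasis, ← functional_tensorBasis, hS]
  apply CGAlgebra.ext
  funext p q
  refine CG.hom_ext fun Γ => ?_
  exact (LinearMap.toMatrix (tensorBasis B p) (tensorBasis B q)).injective (hM Γ)

/-- The data of the state sums of a symmetric algebra structure. -/
noncomputable def SymmetricAlgebraStructure.stateSumData {k : Type*} [Field k] {V : Type*}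
    [AddCommGroup V] [Module k V] {I : Type*} [Fintype I] [DecidableEq I] {r₀ : ℕ}
    (A : SymmetricAlgebraStructure k V r₀) (B : Module.Basis I k V) :
    StateSumData k V I r₀ where
  β x y := A.b x y
  symm := A.b_symm.eq
  e := B
  d := A.b.dualBasis A.b_nondegenerate B
  contract x y := by
    -- Pairing with the dual basis extracts coordinates, so the contraction is `b` applied to the
    -- expansion of `x` in the basis.
    have h : ∀ i, B.repr x i = A.b x (A.b.dualBasis A.b_nondegenerate B i) := by
      intro i
      conv_rhs => rw [← B.sum_repr x, map_sum, LinearMap.sum_apply]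
      simp only [map_smul, LinearMap.smul_apply, smul_eq_mul, mul_ite, mul_one, mul_zero,
        LinearMap.BilinForm.apply_dualBasis_right A.b_nondegenerate A.b_symm, Finset.sum_ite_eq',
        Finset.mem_univ, if_true]
    conv_rhs => rw [← B.sum_repr x]
    simp [h]
  dual := LinearMap.BilinForm.apply_dualBasis_right A.b_nondegenerate A.b_symm B
  s r hr X := A.S r hr (PiTensorProduct.tprod k X)
  s_symm r hr σ X := (A.S_symm r hr σ X).symm

/-- The state sums formed with a basis and its `b`-dual basis give a preimage; it need only be
evaluated on `cap` and the corollas. -/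
theorem CGAlgebra.toSymmetricAlgebraStructure_surjective {k : Type*} [Field k] {V : Type*}
    [AddCommGroup V] [Module k V] [FiniteDimensional k V] {r₀ : ℕ} :
    Function.Surjective (toSymmetricAlgebraStructure : CGAlgebra k V r₀ → _) := by
  intro A
  let B := Module.finBasis k V
  have hM := (A.stateSumData B).isMatrixProp
  refine ⟨hM.toCGAlgebra B, SymmetricAlgebraStructure.ext ?_ ?_⟩
  · refine LinearMap.BilinForm.ext_basis B fun i j => ?_
    refine (form_basis B _ i j).trans ?_
    rw [hM.matrix_toCGAlgebra]
    exact (A.stateSumData B).stateSum_cap i j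
  · funext r hr
    refine (tensorBasis B r).ext fun c => ?_
    refine (functional_tensorBasis B _ _ c).trans ?_
    rw [hM.matrix_toCGAlgebra, tensorBasis_apply]
    exact (A.stateSumData B).stateSum_corolla hr c

end GraphProp

theorem theorem2 (k : Type*) [Field k] (V : Type*) [AddCommGroup V] [Module k V]
    [FiniteDimensional k V] (r₀ : ℕ) :
    ∃ F : GraphProp.CGAlgebra k V r₀ ≃ GraphProp.SymmetricAlgebraStructure k V r₀,
      ∀ Z : GraphProp.CGAlgebra k V r₀,
        (∀ x y : V, (F Z).b x y =
          Z.functional (GraphProp.TypedGraph.cap r₀) (PiTensorProduct.tprod k ![x, y])) ∧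
        ∀ (r : ℕ) (hr : r₀ ≤ r), (F Z).S r hr =
          Z.functional (GraphProp.TypedGraph.corolla r₀ r hr) :=
  ⟨Equiv.ofBijective GraphProp.CGAlgebra.toSymmetricAlgebraStructure
    ⟨GraphProp.CGAlgebra.toSymmetricAlgebraStructure_injective,
      GraphProp.CGAlgebra.toSymmetricAlgebraStructure_surjective⟩,
    fun _ => ⟨fun _ _ => rfl, fun _ _ => rfl⟩⟩
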